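/- Let $\mathcal H$ be a complex separable Hilbert space with orthonormal basis $(e_i)_{i\ge 1}$, and let $\mathfrak F_M(\mathcal H)$ be the discrete monotone Fock space, i.e. the closed subspace of the full Fock space $\bigoplus_{k\ge 0}\mathcal H^{\otimes k}$ spanned by the vacuum vector $\Omega=1\oplus 0\oplus\cdots$ and the vectors $e_{(i_k,\dots,i_1)}:=e_{i_k}\otimes\cdots\otimes e_{i_1}$ with $k\ge 1$ and $i_k>\cdots>i_1$. For $i\ge 1$ let $a_i^\dagger$ and $a_i$ be the (bounded, mutually adjoint) monotone creation and annihilation operators on $\mathfrak F_M(\mathcal H)$: $a_i^\dagger\Omega=e_{(i)}$, $a_i\Omega=0$ and, for $k\ge1$, $a_i^\dagger e_{(i_k,\dots,i_1)}=e_{(i,i_k,\dots,i_1)}$ if $i>i_k$ and $0$ otherwise, while $a_i e_{(i_k,\dots,i_1)}=e_{(i_{k-1},\dots,i_1)}$ if $i=i_k$ and $0$ otherwise (with $e_{(i_{k-1},\dots,i_1)}=\Omega$ if $k=1$). Put $a_i^0:=a_i^\dagger a_i$ and, for $m\ge 1$ and $\kappa\in\mathbb R$, let $P_m(\kappa):=\sum_{i=1}^m\bigl(a_i+a_i^\dagger+\kappa\,a_i^0\bigr)$.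 The vacuum law of a bounded self-adjoint operator $T$ is the Borel probability measure $\mu$ on $\mathbb R$ with $\int f\,d\mu=\langle f(T)\Omega,\Omega\rangle$ for all continuous $f:\mathbb R\to\mathbb R$. Then for every $\lambda>0$ the vacuum law of $$\frac{P_m(\lambda\sqrt m)}{\sqrt m}$$ converges weakly, as $m\to\infty$, to the probability measure $$\nu_\lambda=\frac{\lambda}{\sqrt{\lambda^2+2}}\,\delta_{\lambda-\sqrt{\lambda^2+2}}+\frac{\sqrt{2-(x-\lambda)^2}}{\pi\bigl(\lambda^2+2-(x-\lambda)^2\bigr)}\,\chi_{(\lambda-\sqrt2,\lambda+\sqrt2)}(x)\,dx .$$ -/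

import Mathlib

open MeasureTheory Filter Topology
open scoped TensorProduct CompactlySupported

universe u

namespace MonotoneFock

noncomputable section

/-! ### The full Fock space -/

/-- A complex Hilbert space, bundled. -/
structure HilbertObj : Type (u + 1) where
  carrier : Type u
  [normed : NormedAddCommGroup carrier]
  [innerProd : InnerProductSpace ℂ carrier]
  [complete : CompleteSpace carrier]

attribute [instance] HilbertObj.normed HilbertObj.innerProd HilbertObj.complete

/-- The Hilbert space tensor powers of `H`: the zeroth one is the one-dimensional space, and
`H^{⊗(n+1)}` is the completion of the algebraic tensor product `H ⊗ H^{⊗n}` with respect to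
`⟪x ⊗ y, x' ⊗ y'⟫ = ⟪x, x'⟫ ⟪y, y'⟫`. -/
def tensorPow (H : Type u) [NormedAddCommGroup H] [InnerProductSpace ℂ H] : ℕ → HilbertObj.{u}
  | 0 => ⟨EuclideanSpace ℂ PUnit.{u + 1}⟩
  | n + 1 => ⟨UniformSpace.Completion (H ⊗[ℂ] (tensorPow H n).carrier)⟩

variable {H : Type u} [NormedAddCommGroup H] [InnerProductSpace ℂ H]

variable (H) in
/-- The full Fock space over `H`: the Hilbert space direct sum of all tensor powers of `H`. -/
def FullFock : Type u := lp (fun n : ℕ => (tensorPow H n).carrier) 2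

instance : NormedAddCommGroup (FullFock H) :=
  inferInstanceAs (NormedAddCommGroup (lp (fun n : ℕ => (tensorPow H n).carrier) 2))

instance : InnerProductSpace ℂ (FullFock H) :=
  inferInstanceAs (InnerProductSpace ℂ (lp (fun n : ℕ => (tensorPow H n).carrier) 2))

instance : CompleteSpace (FullFock H) :=
  inferInstanceAs (CompleteSpace (lp (fun n : ℕ => (tensorPow H n).carrier) 2))

/-- The `n`-particle component of a vector of the full Fock space. -/
def FullFock.component (ξ : FullFock H) (n : ℕ) : (tensorPow H n).carrier :=
  (show lp (fun n : ℕ => (tensorPow H n).carrier) 2 from ξ : ∀ n : ℕ, (tensorPow H n).carrier) n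

theorem FullFock.ext {ξ η : FullFock H} (h : ∀ n, ξ.component n = η.component n) : ξ = η :=
  Subtype.ext (funext h)

theorem FullFock.component_add (ξ η : FullFock H) (n : ℕ) :
    (ξ + η).component n = ξ.component n + η.component n := rfl

theorem FullFock.component_smul (c : ℂ) (ξ : FullFock H) (n : ℕ) :
    (c • ξ).component n = c • ξ.component n := rfl

theorem FullFock.hasSum_inner (ξ η : FullFock H) :
    HasSum (fun n => inner ℂ (ξ.component n) (η.component n)) (inner ℂ ξ η) :=
  lp.hasSum_inner (𝕜 := ℂ) (G := fun n : ℕ => (tensorPow H n).carrier) ξ η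

theorem FullFock.hasSum_norm_sq (ξ : FullFock H) :
    HasSum (fun n => ‖ξ.component n‖ ^ 2) (‖ξ‖ ^ 2) := by
  have := lp.hasSum_norm (E := fun n : ℕ => (tensorPow H n).carrier) (p := 2) (by norm_num) ξ
  simp only [ENNReal.toReal_ofNat, Real.rpow_ofNat] at this
  exact this

/-- A vector of the full Fock space from its components. -/
def FullFock.ofComponents (f : ∀ n : ℕ, (tensorPow H n).carrier)
    (hf : Summable fun n => ‖f n‖ ^ 2) : FullFock H :=
  (⟨f, memℓp_gen (by simpa using hf)⟩ : lp (fun n : ℕ => (tensorPow H n).carrier) 2)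

theorem FullFock.component_ofComponents (f : ∀ n : ℕ, (tensorPow H n).carrier)
    (hf : Summable fun n => ‖f n‖ ^ 2) (n : ℕ) : (ofComponents f hf).component n = f n := rfl

/-- The unit vector of the zeroth tensor power. -/
def unitVec : (tensorPow H 0).carrier := EuclideanSpace.single PUnit.unit (1 : ℂ)

/-- `t ↦ h ⊗ t`, as a bounded operator `H^{⊗n} → H^{⊗(n+1)}`. -/
def tensorLeft (h : H) (n : ℕ) : (tensorPow H n).carrier →L[ℂ] (tensorPow H (n + 1)).carrier :=
  (UniformSpace.Completion.toComplL (𝕜 := ℂ) (E := H ⊗[ℂ] (tensorPow H n).carrier)).comp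
    (TensorProduct.mkL ℂ H (tensorPow H n).carrier h)

/-- The simple tensor `h₁ ⊗ ⋯ ⊗ h_k`; the empty list gives the unit of the zeroth power. -/
def simpleTensor : (l : List H) → (tensorPow H l.length).carrier
  | [] => unitVec
  | h :: l => tensorLeft h l.length (simpleTensor l)

/-- The simple tensor `h₁ ⊗ ⋯ ⊗ h_k` as a vector of the full Fock space; the empty list gives the
vacuum vector `1 ⊕ 0 ⊕ ⋯`. -/
def fockTensor (l : List H) : FullFock H :=
  (lp.single 2 l.length (simpleTensor l) : lp (fun n : ℕ => (tensorPow H n).carrier) 2)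

theorem component_fockTensor_self (l : List H) :
    (fockTensor l).component l.length = simpleTensor l :=
  lp.single_apply_self (E := fun n : ℕ => (tensorPow H n).carrier) 2 _ _

theorem component_fockTensor_ne (l : List H) {n : ℕ} (hn : n ≠ l.length) :
    (fockTensor l).component n = 0 :=
  lp.single_apply_ne (E := fun n : ℕ => (tensorPow H n).carrier) 2 _ _ hn

theorem inner_tensorLeft (h h' : H) (n : ℕ) (x y : (tensorPow H n).carrier) :
    inner ℂ (tensorLeft h n x) (tensorLeft h' n y) = inner ℂ h h' * inner ℂ x y := by
  refine (UniformSpace.Completion.inner_coe (𝕜 := ℂ)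
    (h ⊗ₜ[ℂ] x) (h' ⊗ₜ[ℂ] y)).trans ?_
  exact TensorProduct.inner_tmul ℂ h h' x y

theorem norm_tensorLeft (h : H) (n : ℕ) (x : (tensorPow H n).carrier) :
    ‖tensorLeft h n x‖ = ‖h‖ * ‖x‖ := by
  refine (UniformSpace.Completion.norm_coe (h ⊗ₜ[ℂ] x)).trans ?_
  exact TensorProduct.norm_tmul h x

/-- The components of `h ⊗ ξ` for `ξ` in the full Fock space. -/
def shiftFun (h : H) (ξ : ∀ n : ℕ, (tensorPow H n).carrier) :
    ∀ n : ℕ, (tensorPow H n).carrier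
  | 0 => 0
  | n + 1 => tensorLeft h n (ξ n)

theorem hasSum_shiftFun (h : H) (ξ : FullFock H) :
    HasSum (fun n => ‖shiftFun h ξ.component n‖ ^ 2) ((‖h‖ * ‖ξ‖) ^ 2) := by
  rw [← hasSum_nat_add_iff' 1]
  simp only [shiftFun, norm_tensorLeft, mul_pow, Finset.range_one, Finset.sum_singleton, norm_zero]
  simpa using ξ.hasSum_norm_sq.mul_left (‖h‖ ^ 2)

/-- The left creation operator `ξ ↦ h ⊗ ξ` of the full Fock space. -/
def leftCreation (h : H) : FullFock H →L[ℂ] FullFock H :=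
  LinearMap.mkContinuous
    { toFun := fun ξ => FullFock.ofComponents (shiftFun h ξ.component) (hasSum_shiftFun h ξ).summable
      map_add' := fun ξ η => FullFock.ext fun n => by
        rw [FullFock.component_add]
        simp only [FullFock.component_ofComponents]
        cases n <;> simp [shiftFun, FullFock.component_add]
      map_smul' := fun c ξ => FullFock.ext fun n => by
        rw [FullFock.component_smul]
        simp only [FullFock.component_ofComponents]
        cases n <;> simp [shiftFun, FullFock.component_smul] }
    ‖h‖ (fun ξ => by
      have h1 := (FullFock.ofComponents (shiftFun h ξ.component)
        (hasSum_shiftFun h ξ).summable).hasSum_norm_sq.unique (hasSum_shiftFun h ξ)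
      exact (pow_left_inj₀ (norm_nonneg _) (by positivity) two_ne_zero).1 h1 |>.le)

theorem component_leftCreation (h : H) (ξ : FullFock H) (n : ℕ) :
    (leftCreation h ξ).component n = shiftFun h ξ.component n := rfl

theorem leftCreation_fockTensor (h : H) (l : List H) :
    leftCreation h (fockTensor l) = fockTensor (h :: l) := by
  refine FullFock.ext fun n => ?_
  rw [component_leftCreation]
  rcases n with _ | n
  · rw [component_fockTensor_ne _ (by simp)]
    rfl
  · by_cases hn : n = l.length
    · subst hn
      simp only [shiftFun, component_fockTensor_self]
      exact (component_fockTensor_self (h :: l)).symm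
    · rw [component_fockTensor_ne _ (by simpa using hn)]
      simp only [shiftFun]
      rw [component_fockTensor_ne _ hn, map_zero]

theorem inner_leftCreation (h h' : H) (ξ η : FullFock H) :
    inner ℂ (leftCreation h ξ) (leftCreation h' η) = inner ℂ h h' * inner ℂ ξ η := by
  have h2 := FullFock.hasSum_inner (leftCreation h ξ) (leftCreation h' η)
  refine h2.unique ?_
  rw [← hasSum_nat_add_iff' 1]
  simp only [component_leftCreation, shiftFun, inner_tensorLeft, Finset.range_one,
    Finset.sum_singleton, inner_zero_left, sub_zero]
  exact (FullFock.hasSum_inner ξ η).mul_left _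

theorem inner_vacuum_leftCreation (h : H) (ξ : FullFock H) :
    inner ℂ (fockTensor ([] : List H)) (leftCreation h ξ) = 0 := by
  refine (FullFock.hasSum_inner _ _).unique ?_
  convert hasSum_zero with n
  rcases n with _ | n
  · simp [component_leftCreation, shiftFun]
  · rw [component_fockTensor_ne _ (by simp), inner_zero_left]

theorem inner_vacuum_vacuum :
    inner ℂ (fockTensor ([] : List H)) (fockTensor ([] : List H)) = 1 := by
  have h0 : inner ℂ (unitVec (H := H)) (unitVec (H := H)) = 1 := by
    change inner ℂ (EuclideanSpace.single PUnit.unit (1 : ℂ) : EuclideanSpace ℂ PUnit.{u + 1})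
      (EuclideanSpace.single PUnit.unit (1 : ℂ)) = 1
    simp
  have h1 := FullFock.hasSum_inner (fockTensor ([] : List H)) (fockTensor ([] : List H))
  have h2 := hasSum_single (f := fun n => inner ℂ ((fockTensor ([] : List H)).component n)
    ((fockTensor ([] : List H)).component n)) 0 (fun n hn => by
      rw [component_fockTensor_ne _ (by simpa using hn), inner_zero_left])
  refine (h1.unique h2).trans (Eq.trans ?_ h0)
  have h3 : (fockTensor ([] : List H)).component 0 = unitVec := component_fockTensor_self []
  rw [h3]

/-! ### The monotone Fock space

The orthonormal basis `e₁, e₂, …` of `H` is indexed by `ℕ`, that is, `e i` stands for `e_{i+1}`. -/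

/-- The simple tensors of the basis vectors of `H` are orthonormal. -/
theorem inner_fockTensor_map (e : HilbertBasis ℕ ℂ H) (v w : List ℕ) :
    inner ℂ (fockTensor (v.map e)) (fockTensor (w.map e)) = if v = w then (1 : ℂ) else 0 := by
  induction v generalizing w with
  | nil =>
    cases w with
    | nil => simpa using inner_vacuum_vacuum (H := H)
    | cons j w =>
      rw [List.map_cons, ← leftCreation_fockTensor, List.map_nil, inner_vacuum_leftCreation]
      simp
  | cons i v ih =>
    cases w with
    | nil =>
      rw [← inner_conj_symm, List.map_cons, ← leftCreation_fockTensor, List.map_nil,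
        inner_vacuum_leftCreation]
      simp
    | cons j w =>
      rw [List.map_cons, List.map_cons, ← leftCreation_fockTensor, ← leftCreation_fockTensor,
        inner_leftCreation, ih, orthonormal_iff_ite.1 e.orthonormal i j]
      by_cases h1 : i = j <;> by_cases h2 : v = w <;> simp [h1, h2]

/-- The monotone Fock space: the closed subspace of the full Fock space over `H` spanned by the
simple tensors `e_{i_k} ⊗ ⋯ ⊗ e_{i_1}` with `i_k > ⋯ > i_1`, `k ≥ 0`; the case `k = 0` is the
vacuum. -/
def monotoneFock (e : HilbertBasis ℕ ℂ H) : Submodule ℂ (FullFock H) :=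
  (Submodule.span ℂ
    {ξ | ∃ w : List ℕ, w.Pairwise (· > ·) ∧ ξ = fockTensor (w.map e)}).topologicalClosure

instance (e : HilbertBasis ℕ ℂ H) : CompleteSpace (monotoneFock e) :=
  (Submodule.isClosed_topologicalClosure _).completeSpace_coe

/-- The basis vector `e_{(i_k, …, i_1)}` of the monotone Fock space, `i_k > ⋯ > i_1`. -/
def basisVec (e : HilbertBasis ℕ ℂ H) (w : List ℕ) (hw : w.Pairwise (· > ·)) : monotoneFock e :=
  ⟨fockTensor (w.map e), Submodule.le_topologicalClosure _ (Submodule.subset_span ⟨w, hw, rfl⟩)⟩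

/-- The vacuum vector `Ω`. -/
def vacuum (e : HilbertBasis ℕ ℂ H) : monotoneFock e := basisVec e [] List.Pairwise.nil

/-- The monotone creation operator `a†_i`: the compression to the monotone Fock space of
`ξ ↦ e_i ⊗ ξ`. See `creation_basisVec` and `creation_basisVec_eq_zero`. -/
def creation (e : HilbertBasis ℕ ℂ H) (i : ℕ) : monotoneFock e →L[ℂ] monotoneFock e :=
  (monotoneFock e).orthogonalProjectionOnto.comp
    ((leftCreation (e i)).comp (monotoneFock e).subtypeL)

/-- The monotone annihilation operator `a_i`, the adjoint of `a†_i`.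
See `annihilation_basisVec` and `annihilation_basisVec_eq_zero`. -/
def annihilation (e : HilbertBasis ℕ ℂ H) (i : ℕ) : monotoneFock e →L[ℂ] monotoneFock e :=
  ContinuousLinearMap.adjoint (creation e i)

/-- The preservation operator `a⁰_i = a†_i a_i`. -/
def preservation (e : HilbertBasis ℕ ℂ H) (i : ℕ) : monotoneFock e →L[ℂ] monotoneFock e :=
  (creation e i).comp (annihilation e i)

theorem inner_basisVec (e : HilbertBasis ℕ ℂ H) (v w : List ℕ) (hv : v.Pairwise (· > ·))
    (hw : w.Pairwise (· > ·)) :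
    inner ℂ (basisVec e v hv) (basisVec e w hw) = if v = w then (1 : ℂ) else 0 :=
  inner_fockTensor_map e v w

/-- A vector of the monotone Fock space is determined by its coefficients. -/
theorem ext_basisVec (e : HilbertBasis ℕ ℂ H) {ξ η : monotoneFock e}
    (h : ∀ (w : List ℕ) (hw : w.Pairwise (· > ·)),
      inner ℂ (basisVec e w hw) ξ = inner ℂ (basisVec e w hw) η) : ξ = η := by
  rw [← sub_eq_zero, ← inner_self_eq_zero (𝕜 := ℂ)]
  set ζ : monotoneFock e := ξ - η with hζ
  have h0 : ∀ x ∈ monotoneFock e, inner ℂ x (ζ : FullFock H) = 0 := by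
    intro x hx
    have hcl : IsClosed {x : FullFock H | inner ℂ x (ζ : FullFock H) = 0} :=
      isClosed_eq (by fun_prop) continuous_const
    refine closure_minimal (s := (Submodule.span ℂ
      {ξ | ∃ w : List ℕ, w.Pairwise (· > ·) ∧ ξ = fockTensor (w.map e)} : Set (FullFock H)))
      ?_ hcl hx
    intro y hy
    induction hy using Submodule.span_induction with
    | mem y hy =>
      obtain ⟨w, hw, rfl⟩ := hy
      have := h w hw
      rw [← sub_eq_zero, ← inner_sub_right] at this
      exact this
    | zero => simp
    | add y z _ _ h1 h2 =>
      simp only [Set.mem_ofPred_eq] at h1 h2 ⊢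
      rw [inner_add_left, h1, h2, add_zero]
    | smul c y _ h1 =>
      simp only [Set.mem_ofPred_eq] at h1 ⊢
      rw [inner_smul_left, h1, mul_zero]
  exact h0 ζ ζ.2

theorem inner_creation (e : HilbertBasis ℕ ℂ H) (i : ℕ) (ξ η : monotoneFock e) :
    inner ℂ ξ (creation e i η) = inner ℂ (ξ : FullFock H) (leftCreation (e i) (η : FullFock H)) := by
  simp [creation]

/-- `a†_i e_{(i_1, …, i_k)} = e_{(i, i_1, …, i_k)}` if `k = 0` or `i > i_1`. -/
theorem creation_basisVec (e : HilbertBasis ℕ ℂ H) (i : ℕ) (w : List ℕ)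
    (hw : (i :: w).Pairwise (· > ·)) :
    creation e i (basisVec e w hw.of_cons) = basisVec e (i :: w) hw := by
  refine ext_basisVec e fun v hv => ?_
  rw [inner_creation]
  change _ = inner ℂ _ (fockTensor ((i :: w).map e))
  rw [List.map_cons, ← leftCreation_fockTensor]
  rfl

/-- `a†_i e_{(i_1, …, i_k)} = 0` if `k ≥ 1` and `i ≤ i_1`. -/
theorem creation_basisVec_eq_zero (e : HilbertBasis ℕ ℂ H) (i : ℕ) (w : List ℕ)
    (hw : w.Pairwise (· > ·)) (hi : ¬ (i :: w).Pairwise (· > ·)) :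
    creation e i (basisVec e w hw) = 0 := by
  refine ext_basisVec e fun v hv => ?_
  rw [inner_creation]
  change inner ℂ (fockTensor (v.map e)) (leftCreation (e i) (fockTensor (w.map e))) = _
  rw [leftCreation_fockTensor, ← List.map_cons, inner_fockTensor_map, inner_zero_right, if_neg]
  rintro rfl
  exact hi hv

/-- `a_i e_{(i, i_2, …, i_k)} = e_{(i_2, …, i_k)}`. -/
theorem annihilation_basisVec (e : HilbertBasis ℕ ℂ H) (i : ℕ) (w : List ℕ)
    (hw : (i :: w).Pairwise (· > ·)) :
    annihilation e i (basisVec e (i :: w) hw) = basisVec e w hw.of_cons := by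
  refine ext_basisVec e fun v hv => ?_
  rw [annihilation, ContinuousLinearMap.adjoint_inner_right, inner_basisVec]
  by_cases hi : (i :: v).Pairwise (· > ·)
  · rw [creation_basisVec e i v hi, inner_basisVec]
    simp
  · rw [creation_basisVec_eq_zero e i v hv hi, inner_zero_left, if_neg]
    rintro rfl
    exact hi hw

/-- `a_i Ω = 0`, and `a_i e_{(i_1, …, i_k)} = 0` if `i ≠ i_1`. -/
theorem annihilation_basisVec_eq_zero (e : HilbertBasis ℕ ℂ H) (i : ℕ) (w : List ℕ)
    (hw : w.Pairwise (· > ·)) (hi : ∀ v, w ≠ i :: v) :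
    annihilation e i (basisVec e w hw) = 0 := by
  refine ext_basisVec e fun v hv => ?_
  rw [annihilation, ContinuousLinearMap.adjoint_inner_right, inner_zero_right]
  by_cases hiv : (i :: v).Pairwise (· > ·)
  · rw [creation_basisVec e i v hiv, inner_basisVec, if_neg (fun h => hi v h.symm)]
  · rw [creation_basisVec_eq_zero e i v hv hiv, inner_zero_left]

/-- The vacuum is a unit vector. -/
theorem norm_vacuum (e : HilbertBasis ℕ ℂ H) : ‖vacuum e‖ = 1 := by
  have h : inner ℂ (vacuum e) (vacuum e) = (1 : ℂ) := by
    rw [vacuum, inner_basisVec, if_pos rfl]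
  have h2 : ‖vacuum e‖ ^ 2 = 1 := by
    rw [← inner_self_eq_norm_sq (𝕜 := ℂ), h]
    simp
  exact (pow_eq_one_iff_of_nonneg (norm_nonneg _) two_ne_zero).1 h2

/-- `P_m(κ) = ∑_{i=1}^m (a_i + a†_i + κ a⁰_i)`. -/
def poissonSum (e : HilbertBasis ℕ ℂ H) (m : ℕ) (κ : ℝ) : monotoneFock e →L[ℂ] monotoneFock e :=
  ∑ i ∈ Finset.range m, (annihilation e i + creation e i + (κ : ℂ) • preservation e i)

/-- The rescaled operator `P_m(l √m) / √m`. -/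
def rescaledSum (e : HilbertBasis ℕ ℂ H) (l : ℝ) (m : ℕ) :
    monotoneFock e →L[ℂ] monotoneFock e :=
  ((1 / √(m : ℝ) : ℝ) : ℂ) • poissonSum e m (l * √(m : ℝ))

theorem isSelfAdjoint_smul_sum {K : Type u} [NormedAddCommGroup K] [InnerProductSpace ℂ K]
    [CompleteSpace K] (c : ℕ → K →L[ℂ] K) (r κ : ℝ) (m : ℕ) :
    IsSelfAdjoint ((r : ℂ) • ∑ i ∈ Finset.range m, (ContinuousLinearMap.adjoint (c i) + c i +
      (κ : ℂ) • (c i).comp (ContinuousLinearMap.adjoint (c i)))) := by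
  have hreal : ∀ r : ℝ, IsSelfAdjoint (r : ℂ) := fun r => Complex.conj_ofReal r
  refine IsSelfAdjoint.smul (hreal _) (isSelfAdjoint_sum (Finset.range m) fun i _ => ?_)
  exact (IsSelfAdjoint.star_add_self (c i)).add
    (IsSelfAdjoint.smul (hreal _) (IsSelfAdjoint.mul_star_self (c i)))

theorem isSelfAdjoint_rescaledSum (e : HilbertBasis ℕ ℂ H) (l : ℝ) (m : ℕ) :
    IsSelfAdjoint (rescaledSum e l m) :=
  isSelfAdjoint_smul_sum (creation e) _ _ m

/-! ### The law of a self-adjoint operator in a vector state -/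

section Law

variable {K : Type u} [NormedAddCommGroup K] [InnerProductSpace ℂ K] [CompleteSpace K]

/-- The positive functional `f ↦ ⟪ξ, f(T) ξ⟫` on real continuous functions on the spectrum of the
bounded self-adjoint operator `T`. -/
def vectorFunctional (T : K →L[ℂ] K) (hT : IsSelfAdjoint T) (ξ : K) :
    C_c(spectrum ℝ T, ℝ) →ₚ[ℝ] ℝ :=
  PositiveLinearMap.mk₀
    { toFun := fun f => (inner ℂ ξ (cfcHom hT (f : C(spectrum ℝ T, ℝ)) ξ)).re
      map_add' := fun f g => by
        have : ((f + g : C_c(spectrum ℝ T, ℝ)) : C(spectrum ℝ T, ℝ)) = f + g := rfl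
        rw [this]
        simp
      map_smul' := fun c f => by
        have : ((c • f : C_c(spectrum ℝ T, ℝ)) : C(spectrum ℝ T, ℝ)) =
          c • (f : C(spectrum ℝ T, ℝ)) := rfl
        rw [this]
        simp }
    (fun f hf => by
      have h1 : 0 ≤ cfcHom hT (f : C(spectrum ℝ T, ℝ)) :=
        (cfcHom_nonneg_iff hT).2 fun x => hf x
      have h2 := (ContinuousLinearMap.nonneg_iff_isPositive _).1 h1
      exact (Complex.nonneg_iff.1 (h2.inner_nonneg_right ξ)).1)

/-- The law of the bounded self-adjoint operator `T` in the vector state given by `ξ`: the Borel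
measure on `ℝ`, carried by the spectrum of `T`, with `∫ f dμ = ⟪ξ, f(T) ξ⟫`. -/
def vectorLaw (T : K →L[ℂ] K) (hT : IsSelfAdjoint T) (ξ : K) : Measure ℝ :=
  (RealRMK.rieszMeasure (vectorFunctional T hT ξ)).map Subtype.val

theorem integral_vectorLaw (T : K →L[ℂ] K) (hT : IsSelfAdjoint T) (ξ : K) (f : ℝ → ℝ)
    (hf : Continuous f) :
    ∫ x, f x ∂(vectorLaw T hT ξ) = (inner ℂ ξ (cfc f T ξ)).re := by
  have hs : IsCompact (spectrum ℝ T) := spectrum.isCompact T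
  have : CompactSpace (spectrum ℝ T) := isCompact_iff_compactSpace.1 hs
  rw [vectorLaw, (MeasurableEmbedding.subtype_coe hs.measurableSet).integral_map]
  let g : C(spectrum ℝ T, ℝ) := ⟨fun x => f x, by fun_prop⟩
  let F : C_c(spectrum ℝ T, ℝ) := ⟨g, HasCompactSupport.of_compactSpace _⟩
  refine (RealRMK.integral_rieszMeasure (vectorFunctional T hT ξ) F).trans ?_
  rw [cfc_apply f T hT (hf.continuousOn)]
  rfl

/-- The moments of the law of `T` are the moments of `T` in the vector state. -/
theorem integral_pow_vectorLaw (T : K →L[ℂ] K) (hT : IsSelfAdjoint T) (ξ : K) (n : ℕ) :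
    ∫ x, x ^ n ∂(vectorLaw T hT ξ) = (inner ℂ ξ ((T ^ n) ξ)).re := by
  rw [integral_vectorLaw T hT ξ (fun x => x ^ n) (by fun_prop), cfc_pow_id T n hT]

theorem isProbabilityMeasure_vectorLaw (T : K →L[ℂ] K) (hT : IsSelfAdjoint T) (ξ : K)
    (hξ : ‖ξ‖ = 1) : IsProbabilityMeasure (vectorLaw T hT ξ) := by
  have h := integral_pow_vectorLaw T hT ξ 0
  have h1 : (inner ℂ ξ ξ).re = 1 := by
    rw [inner_self_eq_norm_sq_to_K, hξ]
    simp
  simp only [pow_zero, integral_const, smul_eq_mul, mul_one, one_apply_eq_self, h1] at h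
  constructor
  rw [Measure.real, ENNReal.toReal_eq_one_iff] at h
  exact h

end Law

/-- The vacuum law of `P_m(l √m) / √m`. -/
def vacuumLaw (e : HilbertBasis ℕ ℂ H) (l : ℝ) (m : ℕ) : ProbabilityMeasure ℝ :=
  ⟨vectorLaw (rescaledSum e l m) (isSelfAdjoint_rescaledSum e l m) (vacuum e),
    isProbabilityMeasure_vectorLaw _ _ _ (norm_vacuum e)⟩

/-! ### The limit law -/

/-- The density of the absolutely continuous part of the limit law. -/
def limitDensity (l x : ℝ) : ℝ :=
  (Set.Ioo (l - √2) (l + √2)).indicator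
    (fun x => √(2 - (x - l) ^ 2) / (Real.pi * (l ^ 2 + 2 - (x - l) ^ 2))) x

/-- The limit law `ν_l`: an atom of mass `l / √(l² + 2)` at `l - √(l² + 2)` plus an absolutely
continuous part. -/
def limitLaw (l : ℝ) : Measure ℝ :=
  ENNReal.ofReal (l / √(l ^ 2 + 2)) • Measure.dirac (l - √(l ^ 2 + 2)) +
    volume.withDensity fun x => ENNReal.ofReal (limitDensity l x)

end

end MonotoneFock

/-!
The limit is identified through Cauchy transforms, and these can be computed exactly.

Write `T = P_m(l √m) / √m`. The product vectors `φ_n = (1 + b_{n-1} a†_{n-1}) ⋯ (1 + b_0 a†_0) Ω`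
satisfy `a_j φ_m = b_j φ_j` and `a†_j φ_m = a†_j φ_j`, so `T φ_m` is a sum over `j < m` of
combinations of `φ_j` and `φ_{j+1}`. It telescopes to `z φ_m - (l + u_m) Ω` when `b_j` is
`1 / (√m u_{m-1-j})`, where `u_0 = z - l` and `u_{k+1} = u_k - 1 / (m u_k)`
(`rescaledSum_productVec`). As `⟪Ω, φ_m⟫ = 1`, the Cauchy transform of the vacuum law at `z` is
`1 / (l + u_m)` (`integral_inv_sub_vacuumLaw`).

The recursion for `u` is the Euler scheme with step `1 / m` for `w' = -1 / w`. It does not decrease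
the imaginary part, and `u_k²` drops by `2 / m` at each step up to an error `O(1 / m²)`. Hence `u_m`
tends to the root `v` of `v² = (z - l)² - 2` in the upper half-plane (`tendsto_eulerIter`), and the
Cauchy transforms tend to `1 / (l + v)`. That this is the Cauchy transform of the limit law follows
by the substitution `x = l + √2 cos θ` and partial fractions from the Cauchy transform of the
semicircle law (`integral_sin_sq_div_sub_cos`, `integral_inv_sub_limitLaw`); that one in turn comes
from the Poisson kernel and the mean value property.

The vacuum laws have second moment one, so they are tight, and the closed span of the constants and
the functions `x ↦ (z - x)⁻¹` is a point-separating star-algebra by the resolvent identity.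
Convergence of Cauchy transforms therefore gives weak convergence
(`tendsto_of_tendsto_integral_inv_sub`).
-/

namespace MonotoneFock

/-! ### Product vectors and the resolvent equation -/

section Relations

variable {H : Type u} [NormedAddCommGroup H] [InnerProductSpace ℂ H] (e : HilbertBasis ℕ ℂ H)

/-- Bounded operators agree if they agree on the basis vectors. -/
theorem clm_ext_basisVec {A B : monotoneFock e →L[ℂ] monotoneFock e}
    (h : ∀ (w : List ℕ) (hw : w.Pairwise (· > ·)), A (basisVec e w hw) = B (basisVec e w hw)) :
    A = B := by
  rw [← ContinuousLinearMap.adjoint.injective.eq_iff]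
  ext1 ξ
  refine ext_basisVec e fun w hw => ?_
  rw [ContinuousLinearMap.adjoint_inner_right, ContinuousLinearMap.adjoint_inner_right, h]

/-- Creation operators only ever add a new largest index. -/
theorem creation_creation_eq_zero {i j : ℕ} (hij : i ≤ j) (ξ : monotoneFock e) :
    creation e i (creation e j ξ) = 0 := by
  have : (creation e i).comp (creation e j) = 0 := by
    refine clm_ext_basisVec e fun w hw => ?_
    by_cases hj : (j :: w).Pairwise (· > ·)
    · simp only [ContinuousLinearMap.comp_apply, creation_basisVec e j w hj]
      refine creation_basisVec_eq_zero e i (j :: w) hj fun h => ?_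
      have := List.rel_of_pairwise_cons h (List.mem_cons_self (a := j) (l := w))
      omega
    · simp [ContinuousLinearMap.comp_apply, creation_basisVec_eq_zero e j w hw hj]
  simpa using congr($this ξ)

theorem annihilation_creation_eq_zero {i j : ℕ} (hij : i ≠ j) (ξ : monotoneFock e) :
    annihilation e i (creation e j ξ) = 0 := by
  have : (annihilation e i).comp (creation e j) = 0 := by
    refine clm_ext_basisVec e fun w hw => ?_
    by_cases hj : (j :: w).Pairwise (· > ·)
    · simp only [ContinuousLinearMap.comp_apply, creation_basisVec e j w hj]
      refine annihilation_basisVec_eq_zero e i (j :: w) hj fun v h => ?_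
      exact hij (List.cons.inj h).1.symm
    · simp [ContinuousLinearMap.comp_apply, creation_basisVec_eq_zero e j w hw hj]
  simpa using congr($this ξ)

theorem annihilation_vacuum (i : ℕ) : annihilation e i (vacuum e) = 0 :=
  annihilation_basisVec_eq_zero e i [] _ (by simp)

/-- `a_i a†_i` is the projection onto the span of the basis vectors all of whose indices are
below `i`; in particular it fixes the vacuum. -/
theorem annihilation_creation_vacuum (i : ℕ) :
    annihilation e i (creation e i (vacuum e)) = vacuum e := by
  rw [vacuum, creation_basisVec e i [] (by simp), annihilation_basisVec]

theorem annihilation_creation_creation {i j : ℕ} (hij : j < i) (ξ : monotoneFock e) :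
    annihilation e i (creation e i (creation e j ξ)) = creation e j ξ := by
  have : (annihilation e i).comp ((creation e i).comp (creation e j)) = creation e j := by
    refine clm_ext_basisVec e fun w hw => ?_
    by_cases hj : (j :: w).Pairwise (· > ·)
    · have hi : (i :: j :: w).Pairwise (· > ·) := by
        refine List.pairwise_cons.2 ⟨fun k hk => ?_, hj⟩
        rcases List.mem_cons.1 hk with rfl | hk
        · exact hij
        · exact lt_trans (List.rel_of_pairwise_cons hj hk) hij
      simp only [ContinuousLinearMap.comp_apply, creation_basisVec e j w hj]
      rw [creation_basisVec e i _ hi, annihilation_basisVec]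
    · simp [ContinuousLinearMap.comp_apply, creation_basisVec_eq_zero e j w hw hj]
  simpa using congr($this ξ)

theorem inner_vacuum_creation (i : ℕ) (ξ : monotoneFock e) :
    inner ℂ (vacuum e) (creation e i ξ) = 0 := by
  rw [← ContinuousLinearMap.adjoint_inner_left]
  change inner ℂ (annihilation e i (vacuum e)) ξ = 0
  rw [annihilation_vacuum, inner_zero_left]

end Relations

section ResolventVector

variable {H : Type u} [NormedAddCommGroup H] [InnerProductSpace ℂ H] (e : HilbertBasis ℕ ℂ H)

/-- The vector `(1 + b_{n-1} a†_{n-1}) ⋯ (1 + b_0 a†_0) Ω`, that is, the sum over all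
`i_k > ⋯ > i_1` below `n` of `b_{i_k} ⋯ b_{i_1} e_{(i_k, …, i_1)}`. -/
noncomputable def productVec (b : ℕ → ℂ) : ℕ → monotoneFock e
  | 0 => vacuum e
  | n + 1 => productVec b n + b n • creation e n (productVec b n)

theorem productVec_succ (b : ℕ → ℂ) (n : ℕ) :
    productVec e b (n + 1) = productVec e b n + b n • creation e n (productVec e b n) := rfl

theorem inner_vacuum_productVec (b : ℕ → ℂ) (n : ℕ) :
    inner ℂ (vacuum e) (productVec e b n) = 1 := by
  induction n with
  | zero =>
    change inner ℂ (vacuum e) (vacuum e) = 1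
    rw [vacuum, inner_basisVec, if_pos rfl]
  | succ n ih =>
    rw [productVec_succ, inner_add_right, inner_smul_right, inner_vacuum_creation, ih]
    simp

theorem annihilation_creation_productVec (b : ℕ → ℂ) {i n : ℕ} (h : n ≤ i) :
    annihilation e i (creation e i (productVec e b n)) = productVec e b n := by
  induction n with
  | zero => exact annihilation_creation_vacuum e i
  | succ n ih =>
    simp only [productVec_succ, map_add, map_smul, ih (by omega),
      annihilation_creation_creation e (show n < i by omega)]

theorem annihilation_productVec_of_le (b : ℕ → ℂ) {i n : ℕ} (h : n ≤ i) :
    annihilation e i (productVec e b n) = 0 := by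
  induction n with
  | zero => exact annihilation_vacuum e i
  | succ n ih =>
    rw [productVec_succ, map_add, map_smul, ih (by omega),
      annihilation_creation_eq_zero e (show i ≠ n by omega)]
    simp

theorem annihilation_productVec_of_lt (b : ℕ → ℂ) {i n : ℕ} (h : i < n) :
    annihilation e i (productVec e b n) = b i • productVec e b i := by
  induction n, h using Nat.le_induction with
  | base =>
    rw [productVec_succ, map_add, map_smul, annihilation_productVec_of_le e b le_rfl,
      annihilation_creation_productVec e b le_rfl, zero_add]
  | succ n hn ih =>
    rw [productVec_succ, map_add, map_smul, ih,
      annihilation_creation_eq_zero e (show i ≠ n by omega), smul_zero, add_zero]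

theorem creation_productVec_of_le (b : ℕ → ℂ) {i n : ℕ} (h : i ≤ n) :
    creation e i (productVec e b n) = creation e i (productVec e b i) := by
  induction n, h using Nat.le_induction with
  | base => rfl
  | succ n hn ih =>
    rw [productVec_succ, map_add, map_smul, ih, creation_creation_eq_zero e hn, smul_zero, add_zero]

theorem poissonSum_productVec (b : ℕ → ℂ) (m : ℕ) (κ : ℝ) :
    poissonSum e m κ (productVec e b m) = ∑ i ∈ Finset.range m, (b i • productVec e b i +
      creation e i (productVec e b i) + (κ : ℂ) • b i • creation e i (productVec e b i)) := by
  rw [poissonSum, sum_apply]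
  refine Finset.sum_congr rfl fun i hi => ?_
  have hi := Finset.mem_range.1 hi
  simp only [add_apply, smul_apply, preservation,
    ContinuousLinearMap.comp_apply, annihilation_productVec_of_lt e b hi,
    creation_productVec_of_le e b hi.le, map_smul]

/-- If `ρ_{j-1} = ρ_j - 1 / (m ρ_j)`, then the product vector with coefficients
`1 / (√m ρ_j)` solves the resolvent equation up to the factor `l + ρ_{-1}`, with
`ρ_{m-1} = z - l`. The term `ρ_j` is `ρ (j + 1)` in the statement. -/
theorem rescaledSum_productVec (l : ℝ) {m : ℕ} (hm : 0 < m) (ρ : ℕ → ℂ)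
    (h0 : ∀ j < m, ρ (j + 1) ≠ 0)
    (hρ : ∀ j < m, ρ j = ρ (j + 1) - (m : ℂ)⁻¹ / ρ (j + 1)) :
    rescaledSum e l m (productVec e (fun j => ((√(m : ℝ) : ℝ) : ℂ)⁻¹ / ρ (j + 1)) m) =
      (l + ρ m) • productVec e (fun j => ((√(m : ℝ) : ℝ) : ℂ)⁻¹ / ρ (j + 1)) m -
        (l + ρ 0) • vacuum e := by
  set s : ℂ := ((√(m : ℝ) : ℝ) : ℂ) with hs
  have hs2 : s * s = m := by
    rw [hs, ← Complex.ofReal_mul, Real.mul_self_sqrt (by positivity)]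
    simp
  have hs0 : s ≠ 0 := by
    rintro h
    rw [h, zero_mul] at hs2
    exact hm.ne' (by exact_mod_cast hs2.symm)
  set b : ℕ → ℂ := fun j => s⁻¹ / ρ (j + 1) with hb
  have hterm : ∀ i ∈ Finset.range m, s⁻¹ • (b i • productVec e b i +
      creation e i (productVec e b i) + ((l * √(m : ℝ) : ℝ) : ℂ) • b i •
        creation e i (productVec e b i)) =
      (l + ρ (i + 1)) • productVec e b (i + 1) - (l + ρ i) • productVec e b i := by
    intro i hi
    have hi := Finset.mem_range.1 hi
    have h1 := h0 i hi
    have h2 : ρ i = ρ (i + 1) - s⁻¹ * b i := by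
      rw [hρ i hi, hb, ← hs2]
      field_simp
    have h3 : s⁻¹ = ρ (i + 1) * b i := by
      simp only [hb]
      field_simp
    have h4 : s⁻¹ * s = 1 := inv_mul_cancel₀ hs0
    rw [productVec_succ, h2, Complex.ofReal_mul, ← hs]
    generalize creation e i (productVec e b i) = x
    have h5 : s⁻¹ • x = (ρ (i + 1) * b i) • x := by rw [← h3]
    simp only [smul_add, h5]
    simp only [smul_smul]
    rw [show s⁻¹ * (↑l * s * b i) = (s⁻¹ * s) * (↑l * b i) by ring, h4]
    module
  have hscale : rescaledSum e l m = s⁻¹ • poissonSum e m (l * √(m : ℝ)) := by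
    rw [rescaledSum, hs]
    simp
  rw [hscale, smul_apply, poissonSum_productVec, Finset.smul_sum,
    Finset.sum_congr rfl hterm,
    Finset.sum_range_sub (fun i => (l + ρ i) • productVec e b i)]
  rfl

/-- The second moment of the vacuum law is one: `T Ω` is the sum of the `e_{(i)}`, `i < m`, divided
by `√m`. -/
theorem inner_vacuum_rescaledSum_sq (l : ℝ) {m : ℕ} (hm : 0 < m) :
    inner ℂ (vacuum e) ((rescaledSum e l m ^ 2) (vacuum e)) = 1 := by
  have hv : rescaledSum e l m (vacuum e) = ((1 / √(m : ℝ) : ℝ) : ℂ) •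
      ∑ i ∈ Finset.range m, creation e i (vacuum e) := by
    rw [rescaledSum, poissonSum, smul_apply, sum_apply]
    congr 1
    refine Finset.sum_congr rfl fun i _ => ?_
    simp [preservation, annihilation_vacuum]
  have hij : ∀ i j : ℕ, inner ℂ (creation e i (vacuum e)) (creation e j (vacuum e)) =
      if i = j then (1 : ℂ) else 0 := by
    intro i j
    rw [vacuum, creation_basisVec e i [] (by simp), creation_basisVec e j [] (by simp),
      inner_basisVec]
    simp
  have hsa := (ContinuousLinearMap.isSelfAdjoint_iff_isSymmetric.1
    (isSelfAdjoint_rescaledSum e l m)) (vacuum e) (rescaledSum e l m (vacuum e))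
  rw [pow_two]
  refine Eq.trans hsa.symm ?_
  simp only [ContinuousLinearMap.coe_coe]
  rw [hv, inner_smul_left, inner_smul_right, sum_inner]
  simp only [inner_sum, hij, Finset.sum_ite_eq, Finset.mem_range]
  rw [Finset.sum_congr rfl (fun i hi => if_pos (Finset.mem_range.1 hi))]
  have hm' : (0 : ℝ) < m := by exact_mod_cast hm
  rw [Complex.conj_ofReal, Finset.sum_const, Finset.card_range, nsmul_eq_mul, mul_one,
    ← mul_assoc, ← Complex.ofReal_mul, div_mul_div_comm, Real.mul_self_sqrt hm'.le]
  push_cast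
  rw [one_mul, one_div, inv_mul_cancel₀ (by exact_mod_cast hm.ne')]

end ResolventVector

/-! ### Cauchy transforms of spectral laws -/

/-- The resolvent function `x ↦ (z - x)⁻¹`, as a bounded continuous function on `ℝ` for `z` off the
real axis. -/
noncomputable def resolventFun (z : ℂ) (hz : z.im ≠ 0) : BoundedContinuousFunction ℝ ℂ :=
  BoundedContinuousFunction.ofNormedAddCommGroup (fun x : ℝ => (z - x)⁻¹)
    (by
      refine Continuous.inv₀ (by fun_prop) fun x h => hz ?_
      simpa using congr_arg Complex.im h)
    |z.im|⁻¹ fun x => by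
      rw [norm_inv]
      refine inv_anti₀ (abs_pos.2 hz) ?_
      simpa using Complex.abs_im_le_norm (z - x)

theorem resolventFun_apply (z : ℂ) (hz : z.im ≠ 0) (x : ℝ) :
    resolventFun z hz x = (z - x)⁻¹ := rfl

theorem norm_resolventFun_le (z : ℂ) (hz : z.im ≠ 0) : ‖resolventFun z hz‖ ≤ |z.im|⁻¹ :=
  BoundedContinuousFunction.norm_ofNormedAddCommGroup_le _ (by positivity) _

section Law

variable {K : Type u} [NormedAddCommGroup K] [InnerProductSpace ℂ K] [CompleteSpace K]

/-- The Cauchy transform of the law of `T` is computed from a solution of the resolvent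
equation. -/
theorem integral_inv_sub_vectorLaw (T : K →L[ℂ] K) (hT : IsSelfAdjoint T) (ξ : K) (hξ : ‖ξ‖ = 1)
    {z : ℂ} (hz : z.im ≠ 0) (ψ : K) (hψ : z • ψ - T ψ = ξ) :
    ∫ x : ℝ, (z - x)⁻¹ ∂(vectorLaw T hT ξ) = inner ℂ ξ ψ := by
  have := isProbabilityMeasure_vectorLaw T hT ξ hξ
  have hne : ∀ x : ℝ, (z - x) ≠ 0 := fun x h => hz (by simpa using congr_arg Complex.im h)
  have hcont : Continuous fun x : ℝ => (z - x)⁻¹ := (resolventFun z hz).continuous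
  have hint : Integrable (fun x : ℝ => (z - x)⁻¹) (vectorLaw T hT ξ) :=
    (resolventFun z hz).integrable _
  obtain ⟨f, hf⟩ : ∃ f : ℝ → ℝ, f = fun x : ℝ => ((z - x)⁻¹).re := ⟨_, rfl⟩
  obtain ⟨g, hg⟩ : ∃ g : ℝ → ℝ, g = fun x : ℝ => ((z - x)⁻¹).im := ⟨_, rfl⟩
  have hfc : Continuous f := hf ▸ Complex.continuous_re.comp hcont
  have hgc : Continuous g := hg ▸ Complex.continuous_im.comp hcont
  -- the real and imaginary parts of `(z - x) (z - x)⁻¹ = 1`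
  have hre : (fun x => f x * (z.re - x) - z.im * g x) = fun _ => 1 := by
    funext x
    have := congr_arg Complex.re (inv_mul_cancel₀ (hne x))
    simp only [Complex.mul_re, Complex.sub_re, Complex.ofReal_re, Complex.sub_im,
      Complex.ofReal_im, Complex.one_re, sub_zero] at this
    simp only [hf, hg]
    linarith
  have him : (fun x => g x * (z.re - x) + z.im * f x) = fun _ => 0 := by
    funext x
    have := congr_arg Complex.im (inv_mul_cancel₀ (hne x))
    simp only [Complex.mul_im, Complex.sub_re, Complex.ofReal_re, Complex.sub_im,
      Complex.ofReal_im, Complex.one_im, sub_zero] at this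
    simp only [hf, hg]
    linarith
  have hlin : cfc (fun x : ℝ => z.re - x) T = algebraMap ℝ _ z.re - T := by
    rw [cfc_sub _ _ T, cfc_const z.re T, cfc_id' ℝ T]
  have hre' : cfc f T * (algebraMap ℝ _ z.re - T) - z.im • cfc g T = 1 := by
    have hl : Continuous fun x : ℝ => z.re - x := by fun_prop
    rw [← hlin, ← cfc_mul f _ T hfc.continuousOn hl.continuousOn,
      ← cfc_const_mul z.im g T hgc.continuousOn,
      ← cfc_sub (fun x => f x * (z.re - x)) _ T (hfc.mul hl).continuousOn
        (hgc.const_mul _).continuousOn, hre, cfc_const_one ℝ T]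
  have him' : cfc g T * (algebraMap ℝ _ z.re - T) + z.im • cfc f T = 0 := by
    have hl : Continuous fun x : ℝ => z.re - x := by fun_prop
    rw [← hlin, ← cfc_mul g _ T hgc.continuousOn hl.continuousOn,
      ← cfc_const_mul z.im f T hfc.continuousOn,
      ← cfc_add T (fun x => g x * (z.re - x)) _ (hgc.mul hl).continuousOn
        (hfc.const_mul _).continuousOn, him, cfc_const_zero ℝ T]
  have hψ' : ξ = (algebraMap ℝ (K →L[ℂ] K) z.re - T) ψ + (Complex.I * z.im) • ψ := by
    rw [← hψ, Algebra.algebraMap_eq_smul_one]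
    conv_lhs => rw [← Complex.re_add_im z]
    simp only [sub_apply, smul_apply, one_apply_eq_self, ← Complex.coe_smul]
    module
  have hR : cfc f T ξ + Complex.I • cfc g T ξ = ψ := by
    have h1 : cfc f T ((algebraMap ℝ (K →L[ℂ] K) z.re - T) ψ) - (z.im : ℂ) • cfc g T ψ = ψ :=
      congr($hre' ψ)
    have h2 : cfc g T ((algebraMap ℝ (K →L[ℂ] K) z.re - T) ψ) + (z.im : ℂ) • cfc f T ψ = 0 :=
      congr($him' ψ)
    rw [hψ', map_add, map_add, map_smul, map_smul]
    rw [sub_eq_iff_eq_add] at h1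
    rw [← eq_neg_iff_add_eq_zero] at h2
    rw [h1, h2]
    match_scalars
    · ring
    · ring_nf
      simp
    · ring
  have hreal : ∀ p : ℝ → ℝ, ((inner ℂ ξ (cfc p T ξ)).re : ℂ) = inner ℂ ξ (cfc p T ξ) := by
    intro p
    have hsa : IsSelfAdjoint (cfc p T) := cfc_predicate p T
    have := (ContinuousLinearMap.isSelfAdjoint_iff_isSymmetric.1 hsa) ξ ξ
    rw [← Complex.conj_eq_iff_re, inner_conj_symm]
    exact this
  rw [← hR, inner_add_right, inner_smul_right, ← hreal f, ← hreal g,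
    ← integral_vectorLaw T hT ξ f hfc, ← integral_vectorLaw T hT ξ g hgc]
  have := integral_re_add_im hint
  rw [← this, hf, hg]
  simp only [Complex.coe_algebraMap, RCLike.I_to_complex]
  rw [mul_comm Complex.I]
  rfl

end Law

/-! ### The Euler scheme for `w' = -1 / w` -/

/-- The Euler scheme with step `h` for the differential equation `w' = -1 / w`. -/
noncomputable def eulerIter (h : ℝ) (ζ : ℂ) : ℕ → ℂ
  | 0 => ζ
  | k + 1 => eulerIter h ζ k - h / eulerIter h ζ k

theorem eulerIter_succ (h : ℝ) (ζ : ℂ) (k : ℕ) :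
    eulerIter h ζ (k + 1) = eulerIter h ζ k - h / eulerIter h ζ k := rfl

theorem im_le_im_eulerIter {h : ℝ} (hh : 0 ≤ h) {ζ : ℂ} (hζ : 0 < ζ.im) (k : ℕ) :
    ζ.im ≤ (eulerIter h ζ k).im := by
  induction k with
  | zero => exact le_rfl
  | succ k ih =>
    rw [eulerIter_succ, Complex.sub_im, Complex.div_im]
    have h0 : 0 ≤ h * (eulerIter h ζ k).im / Complex.normSq (eulerIter h ζ k) :=
      div_nonneg (mul_nonneg hh (hζ.le.trans ih)) (Complex.normSq_nonneg _)
    simp only [Complex.ofReal_im, Complex.ofReal_re, zero_mul, zero_div, zero_sub]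
    linarith

/-- The square of the solution of `w' = -1 / w` is affine in time, and the Euler scheme respects
this up to second order. -/
theorem norm_eulerIter_sq_sub_le {h : ℝ} (hh : 0 ≤ h) {ζ : ℂ} (hζ : 0 < ζ.im) (k : ℕ) :
    ‖eulerIter h ζ k ^ 2 - (ζ ^ 2 - 2 * h * k)‖ ≤ k * (h / ζ.im) ^ 2 := by
  induction k with
  | zero => simp [eulerIter]
  | succ k ih =>
    have him := im_le_im_eulerIter hh hζ k
    have hnorm : ζ.im ≤ ‖eulerIter h ζ k‖ :=
      him.trans ((le_abs_self _).trans (Complex.abs_im_le_norm _))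
    have hne : eulerIter h ζ k ≠ 0 := norm_pos_iff.1 (hζ.trans_le hnorm)
    have heq : eulerIter h ζ (k + 1) ^ 2 - (ζ ^ 2 - 2 * h * ((k + 1 : ℕ) : ℂ)) =
        (eulerIter h ζ k ^ 2 - (ζ ^ 2 - 2 * h * k)) + (h / eulerIter h ζ k) ^ 2 := by
      rw [eulerIter_succ]
      push_cast
      field_simp
      ring
    rw [heq]
    refine (norm_add_le _ _).trans ?_
    have h2 : ‖((h : ℂ) / eulerIter h ζ k) ^ 2‖ ≤ (h / ζ.im) ^ 2 := by
      rw [norm_pow, norm_div, Complex.norm_real, Real.norm_of_nonneg hh]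
      gcongr
    push_cast
    linarith

/-- The Euler scheme with step `1 / m` converges at time one. -/
theorem tendsto_eulerIter {ζ v : ℂ} (hζ : 0 < ζ.im) (hv : 0 < v.im) (hv2 : v ^ 2 = ζ ^ 2 - 2) :
    Tendsto (fun m : ℕ => eulerIter (m : ℝ)⁻¹ ζ m) atTop (𝓝 v) := by
  rw [tendsto_iff_norm_sub_tendsto_zero]
  have hlim : Tendsto (fun m : ℕ => ((m : ℝ))⁻¹ * ((ζ.im ^ 2)⁻¹ * v.im⁻¹)) atTop (𝓝 0) := by
    simpa using (tendsto_inv_atTop_nhds_zero_nat (𝕜 := ℝ)).mul_const ((ζ.im ^ 2)⁻¹ * v.im⁻¹)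
  refine squeeze_zero' (.of_forall fun m => norm_nonneg _) ?_ hlim
  filter_upwards [eventually_gt_atTop 0] with m hm
  have hm' : (0 : ℝ) < m := by exact_mod_cast hm
  set u := eulerIter (m : ℝ)⁻¹ ζ m with hu
  have h1 := norm_eulerIter_sq_sub_le (inv_nonneg.2 hm'.le) hζ m
  rw [← hu] at h1
  have h2 : u ^ 2 - (ζ ^ 2 - 2 * ((m : ℝ)⁻¹ : ℝ) * m) = (u - v) * (u + v) := by
    have : (m : ℂ) ≠ 0 := by exact_mod_cast hm.ne'
    push_cast
    rw [mul_assoc, inv_mul_cancel₀ this, mul_one, ← hv2]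
    ring
  rw [h2, norm_mul] at h1
  have h3 : v.im ≤ ‖u + v‖ := by
    refine le_trans ?_ ((le_abs_self _).trans (Complex.abs_im_le_norm _))
    have := im_le_im_eulerIter (inv_nonneg.2 hm'.le) hζ m
    rw [Complex.add_im]
    linarith
  have h4 : ‖u - v‖ * v.im ≤ m * ((m : ℝ)⁻¹ / ζ.im) ^ 2 :=
    (mul_le_mul_of_nonneg_left h3 (norm_nonneg _)).trans h1
  calc ‖u - v‖ ≤ (m * ((m : ℝ)⁻¹ / ζ.im) ^ 2) / v.im := (le_div_iff₀ hv).2 h4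
    _ = (m : ℝ)⁻¹ * ((ζ.im ^ 2)⁻¹ * v.im⁻¹) := by field_simp

/-- A non-real `ζ` has a branch of `√(ζ² - 2)` in the upper half-plane. -/
theorem exists_sq_eq_sub_two {ζ : ℂ} (hζ : 0 < ζ.im) : ∃ v : ℂ, v ^ 2 = ζ ^ 2 - 2 ∧ 0 < v.im := by
  obtain ⟨v, hv⟩ := IsAlgClosed.exists_pow_nat_eq (ζ ^ 2 - 2) two_pos
  rcases lt_trichotomy v.im 0 with h | h | h
  · exact ⟨-v, by rw [neg_sq, hv], by simpa using h⟩
  · have h1 := congr_arg Complex.re hv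
    have h2 := congr_arg Complex.im hv
    simp [pow_two, h] at h1 h2
    exfalso
    rcases mul_eq_zero.1 (show ζ.re * ζ.im = 0 by linarith) with h0 | h0
    · rw [h0] at h1
      nlinarith [mul_pos hζ hζ]
    · exact hζ.ne' h0
  · exact ⟨v, hv, h⟩

/-! ### The Cauchy transform of the semicircle law -/

open Complex in
/-- The mean value property of `w ↦ (1 - r w)⁻¹` on the unit disc. -/
theorem integral_inv_one_sub_mul_exp {r : ℂ} (hr : ‖r‖ < 1) :
    ∫ θ in -Real.pi..Real.pi, (1 - r * exp (θ * I))⁻¹ = 2 * Real.pi := by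
  have hd : DiffContOnCl ℂ (fun w : ℂ => (1 - r * w)⁻¹) (Metric.ball 0 |(1 : ℝ)|) := by
    refine DifferentiableOn.diffContOnCl fun w hw => ?_
    have hw' : ‖w‖ ≤ 1 := by
      simpa [closure_ball (0 : ℂ) one_ne_zero] using hw
    refine DifferentiableAt.differentiableWithinAt ?_
    refine DifferentiableAt.inv (by fun_prop) fun h => ?_
    have h1 : r * w = 1 := (sub_eq_zero.1 h).symm
    have h2 : ‖r‖ * ‖w‖ = 1 := by rw [← norm_mul, h1, norm_one]
    nlinarith [norm_nonneg r, norm_nonneg w]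
  have h := hd.circleAverage
  rw [Real.circleAverage_def] at h
  have hper : Function.Periodic (fun θ : ℝ => (1 - r * exp (θ * I))⁻¹) (2 * Real.pi) := by
    intro θ
    simp only
    rw [show ((θ + 2 * Real.pi : ℝ) : ℂ) * I = θ * I + 2 * Real.pi * I by push_cast; ring,
      exp_add, exp_two_pi_mul_I, mul_one]
  have h2 := hper.intervalIntegral_add_eq (-Real.pi) 0
  rw [show -Real.pi + 2 * Real.pi = Real.pi by ring, zero_add] at h2
  rw [h2]
  simp only [circleMap_zero, ofReal_one, one_mul, mul_zero, sub_zero, inv_one, real_smul] at h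
  have hpi : (Real.pi : ℂ) ≠ 0 := by exact_mod_cast Real.pi_ne_zero
  push_cast at h
  rw [inv_mul_eq_iff_eq_mul₀ (mul_ne_zero two_ne_zero hpi), mul_one] at h
  exact h

section Semicircle

variable {ζ u : ℂ}

/-- The substitution behind the integral `∫ (ζ - √2 cos θ)⁻¹ dθ`: for `r = (ζ - u) / √2`, where `u`
is the branch of `√(ζ² - 2)` with `Re (ζ ū) > 0`, so that `|ζ - u| < |ζ + u|`, the kernel is a multiple of the Poisson kernel
`(1 - r²) / ((1 - r e^{iθ}) (1 - r e^{-iθ}))`. -/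
theorem exists_poisson_param (hu : u ^ 2 = ζ ^ 2 - 2) (hpos : 0 < (ζ * starRingEnd ℂ u).re) :
    ∃ r : ℂ, ‖r‖ < 1 ∧ ((√2 : ℝ) : ℂ) * r * ζ = 1 + r ^ 2 ∧
      ((√2 : ℝ) : ℂ) * r * u = 1 - r ^ 2 := by
  have h2 : ((√2 : ℝ) : ℂ) ^ 2 = 2 := by
    rw [← Complex.ofReal_pow, Real.sq_sqrt (by norm_num)]
    norm_num
  have h20 : ((√2 : ℝ) : ℂ) ≠ 0 := fun h => by norm_num [h] at h2
  refine ⟨(ζ - u) / (√2 : ℝ), ?_, ?_, ?_⟩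
  · have h3 : ‖ζ - u‖ * ‖ζ + u‖ = 2 := by
      rw [← norm_mul, show (ζ - u) * (ζ + u) = 2 by linear_combination -hu]
      norm_num
    have h4 : ‖ζ - u‖ ^ 2 < ‖ζ + u‖ ^ 2 := by
      rw [Complex.sq_norm, Complex.sq_norm, Complex.normSq_sub, Complex.normSq_add]
      linarith
    have h5 : ‖ζ - u‖ < ‖ζ + u‖ := lt_of_pow_lt_pow_left₀ 2 (norm_nonneg _) h4
    have h6 : ‖ζ - u‖ < √2 := by
      refine Real.lt_sqrt_of_sq_lt ?_
      have : 0 < ‖ζ - u‖ := by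
        rcases (norm_nonneg (ζ - u)).eq_or_lt with h | h
        · rw [← h] at h3
          norm_num at h3
        · exact h
      nlinarith
    rw [norm_div, Complex.norm_real, Real.norm_of_nonneg (Real.sqrt_nonneg _),
      div_lt_one (by positivity)]
    exact h6
  · rw [mul_div_cancel₀ _ h20, div_pow, h2]
    linear_combination (-1 / 2) * hu
  · rw [mul_div_cancel₀ _ h20, div_pow, h2]
    linear_combination (-1 / 2) * hu

open Complex in
theorem sqrt_two_mul_sub_cos {r : ℂ} (h : ((√2 : ℝ) : ℂ) * r * ζ = 1 + r ^ 2) (θ : ℝ) :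
    ((√2 : ℝ) : ℂ) * r * (ζ - ((√2 * Real.cos θ : ℝ) : ℂ)) =
      (1 - r * exp (θ * I)) * (1 - r * exp (-θ * I)) := by
  have h2 : ((√2 : ℝ) : ℂ) ^ 2 = 2 := by
    rw [← Complex.ofReal_pow, Real.sq_sqrt (by norm_num)]
    norm_num
  have h3 : exp (θ * I) * exp (-θ * I) = 1 := by
    rw [← exp_add, neg_mul, add_neg_cancel, exp_zero]
  have h4 : exp (θ * I) + exp (-θ * I) = 2 * cos θ := (two_cos θ).symm
  rw [ofReal_mul, ofReal_cos]
  linear_combination h - r * cos θ * h2 - r ^ 2 * h3 + r * h4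

open Complex in
theorem one_sub_mul_exp_ne_zero {r : ℂ} (hr : ‖r‖ < 1) (θ : ℝ) : 1 - r * exp (θ * I) ≠ 0 := by
  intro h
  have h1 : r * exp (θ * I) = 1 := (sub_eq_zero.1 h).symm
  have h2 : ‖r‖ = 1 := by
    have := congr_arg norm h1
    rwa [norm_mul, norm_exp_ofReal_mul_I, mul_one, norm_one] at this
  exact hr.ne h2

theorem sub_cos_ne_zero (hu : u ^ 2 = ζ ^ 2 - 2) (hpos : 0 < (ζ * starRingEnd ℂ u).re) (θ : ℝ) :
    ζ - ((√2 * Real.cos θ : ℝ) : ℂ) ≠ 0 := by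
  obtain ⟨r, hr, h1, -⟩ := exists_poisson_param hu hpos
  intro h
  have h2 := sqrt_two_mul_sub_cos h1 θ
  rw [h, mul_zero] at h2
  have h3 := one_sub_mul_exp_ne_zero hr (-θ)
  push_cast at h3
  exact mul_ne_zero (one_sub_mul_exp_ne_zero hr θ) h3 h2.symm

theorem continuous_inv_sub_cos (hu : u ^ 2 = ζ ^ 2 - 2) (hpos : 0 < (ζ * starRingEnd ℂ u).re) :
    Continuous fun θ : ℝ => (ζ - ((√2 * Real.cos θ : ℝ) : ℂ))⁻¹ :=
  Continuous.inv₀ (by fun_prop) (sub_cos_ne_zero hu hpos)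

theorem continuous_sin_sq_div_sub_cos (hu : u ^ 2 = ζ ^ 2 - 2)
    (hpos : 0 < (ζ * starRingEnd ℂ u).re) :
    Continuous fun θ : ℝ =>
      ((2 * Real.sin θ ^ 2 : ℝ) : ℂ) * (ζ - ((√2 * Real.cos θ : ℝ) : ℂ))⁻¹ :=
  Continuous.mul (by fun_prop) (continuous_inv_sub_cos hu hpos)

open Complex in
theorem integral_inv_sub_cos (hu : u ^ 2 = ζ ^ 2 - 2) (hpos : 0 < (ζ * starRingEnd ℂ u).re) :
    ∫ θ in (0 : ℝ)..Real.pi, (ζ - ((√2 * Real.cos θ : ℝ) : ℂ))⁻¹ = Real.pi / u := by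
  obtain ⟨r, hr, h1, h2⟩ := exists_poisson_param hu hpos
  have hu0 : u ≠ 0 := by
    rintro rfl
    simp at hpos
  obtain ⟨g, hg⟩ : ∃ g : ℝ → ℂ, g = fun θ : ℝ => (1 - r * exp (θ * I))⁻¹ := ⟨_, rfl⟩
  have hgc : Continuous g := hg ▸ Continuous.inv₀ (by fun_prop) (one_sub_mul_exp_ne_zero hr)
  -- the two halves `g θ` and `g (-θ)` combine to an integral over a full period
  have hterm : ∀ θ : ℝ, (ζ - ((√2 * Real.cos θ : ℝ) : ℂ))⁻¹ = u⁻¹ * (g θ + g (-θ) - 1) := by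
    intro θ
    have h3 := sqrt_two_mul_sub_cos h1 θ
    have h4 := one_sub_mul_exp_ne_zero hr θ
    have h5 := one_sub_mul_exp_ne_zero hr (-θ)
    have h6 := sub_cos_ne_zero hu hpos θ
    have h7 : exp (θ * I) * exp (-θ * I) = 1 := by
      rw [← exp_add, neg_mul, add_neg_cancel, exp_zero]
    push_cast at h5
    simp only [hg, ofReal_neg]
    have h8 : ((√2 : ℝ) : ℂ) * r ≠ 0 := by
      intro h
      rw [h, zero_mul] at h3
      exact mul_ne_zero h4 h5 h3.symm
    have h9 : (1 - r * exp (θ * I))⁻¹ + (1 - r * exp (-θ * I))⁻¹ - 1 =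
        (1 - r ^ 2) / ((1 - r * exp (θ * I)) * (1 - r * exp (-θ * I))) := by
      generalize exp (θ * I) = w at *
      generalize exp (-θ * I) = w' at *
      field_simp
      linear_combination (-r ^ 2) * h7
    have hr0 : r ≠ 0 := right_ne_zero_of_mul h8
    rw [h9, ← h2, ← h3]
    field_simp
  simp only [hterm]
  have hi1 : IntervalIntegrable g volume 0 Real.pi := hgc.intervalIntegrable _ _
  have hi2 : IntervalIntegrable (fun θ => g (-θ)) volume 0 Real.pi :=
    (hgc.comp continuous_neg).intervalIntegrable _ _
  rw [intervalIntegral.integral_const_mul, intervalIntegral.integral_sub (hi1.add hi2) (by simp),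
    intervalIntegral.integral_add hi1 hi2, intervalIntegral.integral_comp_neg, neg_zero,
    add_comm (∫ θ in (0 : ℝ)..Real.pi, g θ), intervalIntegral.integral_add_adjacent_intervals
      (hgc.intervalIntegrable _ _) (hgc.intervalIntegrable _ _), hg,
    integral_inv_one_sub_mul_exp hr]
  simp only [intervalIntegral.integral_const, sub_zero, real_smul, mul_one]
  ring

/-- The Cauchy transform of the semicircle law, in the angular variable. -/
theorem integral_sin_sq_div_sub_cos (hu : u ^ 2 = ζ ^ 2 - 2)
    (hpos : 0 < (ζ * starRingEnd ℂ u).re) :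
    ∫ θ in (0 : ℝ)..Real.pi, ((2 * Real.sin θ ^ 2 : ℝ) : ℂ) * (ζ - ((√2 * Real.cos θ : ℝ) : ℂ))⁻¹ =
      Real.pi * (ζ - u) := by
  have hu0 : u ≠ 0 := by
    rintro rfl
    simp at hpos
  have hc := continuous_inv_sub_cos hu hpos
  -- division with remainder of `2 sin² θ = 2 - X²` by `ζ - X`, for `X = √2 cos θ`
  have hterm : ∀ θ : ℝ,
      ((2 * Real.sin θ ^ 2 : ℝ) : ℂ) * (ζ - ((√2 * Real.cos θ : ℝ) : ℂ))⁻¹ =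
        ((√2 * Real.cos θ : ℝ) : ℂ) + ζ - u ^ 2 * (ζ - ((√2 * Real.cos θ : ℝ) : ℂ))⁻¹ := by
    intro θ
    have h := sub_cos_ne_zero hu hpos θ
    have h2 : 2 * Real.sin θ ^ 2 = 2 - (√2 * Real.cos θ) ^ 2 := by
      rw [mul_pow, Real.sq_sqrt (by norm_num), Real.sin_sq]
      ring
    rw [h2]
    generalize √2 * Real.cos θ = X at h
    push_cast
    field_simp
    linear_combination hu
  simp only [hterm]
  have hi1 : IntervalIntegrable (fun θ : ℝ => ((√2 * Real.cos θ : ℝ) : ℂ)) volume 0 Real.pi :=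
    Continuous.intervalIntegrable (by fun_prop) _ _
  rw [intervalIntegral.integral_sub (hi1.add (by simp))
    ((hc.const_mul (u ^ 2)).intervalIntegrable _ _),
    intervalIntegral.integral_add hi1 (by simp), intervalIntegral.integral_const_mul,
    integral_inv_sub_cos hu hpos, intervalIntegral.integral_ofReal,
    intervalIntegral.integral_const_mul, integral_cos]
  simp only [Real.sin_pi, Real.sin_zero, sub_self, mul_zero, Complex.ofReal_zero,
    intervalIntegral.integral_const, sub_zero, Complex.real_smul]
  field_simp
  ring

end Semicircle

/-! ### Weak convergence from Cauchy transforms -/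

section WeakConvergence

open BoundedContinuousFunction

theorem resolventFun_sub (z w : ℂ) (hz : z.im ≠ 0) (hw : w.im ≠ 0) :
    resolventFun z hz - resolventFun w hw = (w - z) • (resolventFun z hz * resolventFun w hw) := by
  ext x
  have h1 : z - x ≠ 0 := fun h => hz (by simpa using congr_arg Complex.im h)
  have h2 : w - x ≠ 0 := fun h => hw (by simpa using congr_arg Complex.im h)
  simp only [BoundedContinuousFunction.sub_apply, BoundedContinuousFunction.smul_apply,
    BoundedContinuousFunction.mul_apply, resolventFun_apply, smul_eq_mul]
  field_simp
  ring

/-- The constants and the resolvent functions. -/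
def resolventFuns : Set (ℝ →ᵇ ℂ) := {f | f = 1 ∨ ∃ z, ∃ hz : z.im ≠ 0, f = resolventFun z hz}

/-- The closed linear span of the constants and the resolvent functions. -/
noncomputable def resolventSpan : Submodule ℂ (ℝ →ᵇ ℂ) :=
  (Submodule.span ℂ resolventFuns).topologicalClosure

theorem isClosed_resolventSpan : IsClosed (resolventSpan : Set (ℝ →ᵇ ℂ)) :=
  Submodule.isClosed_topologicalClosure _

theorem mem_resolventSpan {f : ℝ →ᵇ ℂ} (hf : f ∈ resolventFuns) : f ∈ resolventSpan :=
  Submodule.le_topologicalClosure _ (Submodule.subset_span hf)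

/-- Products of resolvent functions: for distinct parameters this is the resolvent identity; squares are limits of products with
distinct parameters. -/
theorem resolventFun_mul_mem (z w : ℂ) (hz : z.im ≠ 0) (hw : w.im ≠ 0) :
    resolventFun z hz * resolventFun w hw ∈ resolventSpan := by
  have hne : ∀ (w : ℂ) (hw : w.im ≠ 0), z ≠ w →
      resolventFun z hz * resolventFun w hw ∈ resolventSpan := by
    intro w hw hzw
    have h := resolventFun_sub z w hz hw
    rw [← inv_smul_eq_iff₀ (sub_ne_zero.2 hzw.symm)] at h
    rw [← h]
    exact Submodule.smul_mem _ _ (Submodule.sub_mem _ (mem_resolventSpan (.inr ⟨z, hz, rfl⟩))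
      (mem_resolventSpan (.inr ⟨w, hw, rfl⟩)))
  by_cases hzw : z = w
  · subst hzw
    -- approximate `z` by `z + i t Im z` with `t > 0`, which only moves away from the real axis
    have him : ∀ t : ℝ, (z + (t : ℂ) * (z.im * Complex.I)).im = (1 + t) * z.im := by
      intro t
      simp
      ring
    refine isClosed_resolventSpan.mem_of_tendsto (b := 𝓝[>] (0 : ℝ))
      (f := fun t : ℝ => if h : (z + (t : ℂ) * (z.im * Complex.I)).im ≠ 0 then
        resolventFun z hz * resolventFun (z + (t : ℂ) * (z.im * Complex.I)) h else 0) ?_ ?_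
    · rw [tendsto_iff_norm_sub_tendsto_zero]
      have hlim : Tendsto (fun t : ℝ => t * (|z.im| * (|z.im|⁻¹ * (|z.im|⁻¹ * |z.im|⁻¹))))
          (𝓝[>] 0) (𝓝 0) := by
        have : Continuous fun t : ℝ => t * (|z.im| * (|z.im|⁻¹ * (|z.im|⁻¹ * |z.im|⁻¹))) := by
          fun_prop
        simpa using (this.tendsto 0).mono_left nhdsWithin_le_nhds
      refine squeeze_zero' (.of_forall fun _ => norm_nonneg _) ?_ hlim
      filter_upwards [self_mem_nhdsWithin] with t ht
      have ht : 0 < t := ht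
      have h : (z + (t : ℂ) * (z.im * Complex.I)).im ≠ 0 := by
        rw [him]
        exact mul_ne_zero (by positivity) hz
      rw [dif_pos h, ← mul_sub, ← neg_sub, resolventFun_sub z _ hz h]
      have hle : ‖resolventFun (z + (t : ℂ) * (z.im * Complex.I)) h‖ ≤ |z.im|⁻¹ := by
        refine (norm_resolventFun_le _ h).trans (inv_anti₀ (abs_pos.2 hz) ?_)
        rw [him, abs_mul, abs_of_pos (by positivity : (0 : ℝ) < 1 + t)]
        nlinarith [abs_nonneg z.im]
      have hz' := norm_resolventFun_le z hz
      rw [mul_neg, norm_neg, mul_smul_comm, norm_smul, add_sub_cancel_left, norm_mul, norm_mul,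
        Complex.norm_I, mul_one, Complex.norm_real, Complex.norm_real, Real.norm_of_nonneg ht.le,
        Real.norm_eq_abs, mul_assoc]
      gcongr
      refine (norm_mul_le _ _).trans ?_
      gcongr
      refine (norm_mul_le _ _).trans ?_
      gcongr
    · filter_upwards [self_mem_nhdsWithin] with t ht
      have ht : 0 < t := ht
      have h : (z + (t : ℂ) * (z.im * Complex.I)).im ≠ 0 := by
        rw [him]
        exact mul_ne_zero (by positivity) hz
      rw [dif_pos h]
      refine hne _ h fun heq => ?_
      have := congr_arg Complex.im heq
      rw [him] at this
      rcases mul_eq_zero.1 (show t * z.im = 0 by linarith) with h0 | h0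
      exacts [ht.ne' h0, hz h0]
  · exact hne w hw hzw

theorem mul_mem_resolventSpan {f g : ℝ →ᵇ ℂ} (hf : f ∈ resolventSpan) (hg : g ∈ resolventSpan) :
    f * g ∈ resolventSpan := by
  have hset : ∀ f ∈ resolventFuns, ∀ g ∈ resolventFuns, f * g ∈ resolventSpan := by
    rintro f (rfl | ⟨z, hz, rfl⟩) g hg
    · rw [one_mul]
      exact mem_resolventSpan hg
    · rcases hg with rfl | ⟨w, hw, rfl⟩
      · rw [mul_one]
        exact mem_resolventSpan (.inr ⟨z, hz, rfl⟩)
      · exact resolventFun_mul_mem z w hz hw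
  have hspan : ∀ f ∈ Submodule.span ℂ resolventFuns, ∀ g ∈ Submodule.span ℂ resolventFuns,
      f * g ∈ resolventSpan := fun f hf g hg => by
    have h : Submodule.span ℂ resolventFuns * Submodule.span ℂ resolventFuns ≤ resolventSpan := by
      rw [Submodule.span_mul_span, Submodule.span_le]
      rintro _ ⟨f, hf, g, hg, rfl⟩
      exact hset f hf g hg
    exact h (Submodule.mul_mem_mul hf hg)
  have h := map_mem_closure₂ (t := (Submodule.span ℂ resolventFuns : Set (ℝ →ᵇ ℂ)))
    (u := (resolventSpan : Set (ℝ →ᵇ ℂ))) continuous_mul hf hg hspan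
  rwa [isClosed_resolventSpan.closure_eq] at h

theorem star_mem_resolventSpan {f : ℝ →ᵇ ℂ} (hf : f ∈ resolventSpan) :
    star f ∈ resolventSpan := by
  have hspan : ∀ f ∈ Submodule.span ℂ resolventFuns, star f ∈ resolventSpan := by
    intro f hf
    induction hf using Submodule.span_induction with
    | mem f hf =>
      refine mem_resolventSpan ?_
      rcases hf with rfl | ⟨z, hz, rfl⟩
      · exact .inl (star_one _)
      · refine .inr ⟨starRingEnd ℂ z, by simpa using hz, ?_⟩
        ext x
        simp [resolventFun_apply]
    | zero => simp
    | add f g _ _ h1 h2 =>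
      rw [star_add]
      exact Submodule.add_mem _ h1 h2
    | smul c f _ h =>
      rw [star_smul]
      exact Submodule.smul_mem _ _ h
  have h := map_mem_closure (t := (resolventSpan : Set (ℝ →ᵇ ℂ))) continuous_star hf hspan
  rwa [isClosed_resolventSpan.closure_eq] at h

/-- The closed linear span of the constants and the resolvent functions is an algebra. -/
noncomputable def resolventAlgebra : StarSubalgebra ℂ (ℝ →ᵇ ℂ) where
  carrier := resolventSpan
  mul_mem' := mul_mem_resolventSpan
  add_mem' := resolventSpan.add_mem
  algebraMap_mem' c := by
    rw [Algebra.algebraMap_eq_smul_one]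
    exact resolventSpan.smul_mem _ (mem_resolventSpan (.inl rfl))
  star_mem' := star_mem_resolventSpan

/-- A tight sequence of probability measures on `ℝ` converges weakly as soon as the Cauchy
transforms converge on the upper half-plane to that of a probability measure. -/
theorem tendsto_of_tendsto_integral_inv_sub {μ : ℕ → ProbabilityMeasure ℝ}
    {ν : ProbabilityMeasure ℝ} (ht : IsTightMeasureSet {(μ n : Measure ℝ) | n})
    (h : ∀ z : ℂ, 0 < z.im → Tendsto (fun n => ∫ x : ℝ, (z - x)⁻¹ ∂(μ n : Measure ℝ)) atTop
      (𝓝 (∫ x : ℝ, (z - x)⁻¹ ∂(ν : Measure ℝ)))) :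
    Tendsto μ atTop (𝓝 ν) := by
  refine ProbabilityMeasure.tendsto_of_tight_of_separatesPoints ℂ ht (A := resolventAlgebra) ?_ ?_
  · intro x y hxy
    have hI : Complex.I.im ≠ 0 := by simp
    refine ⟨_, ⟨_, ⟨resolventFun Complex.I hI, mem_resolventSpan (.inr ⟨_, hI, rfl⟩), rfl⟩, rfl⟩,
      fun heq => hxy ?_⟩
    have heq : (Complex.I - x)⁻¹ = (Complex.I - y)⁻¹ := heq
    simpa using inv_injective heq
  · have hspan : ∀ f ∈ Submodule.span ℂ resolventFuns, Tendsto (fun n => ∫ x, f x ∂(μ n : Measure ℝ))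
        atTop (𝓝 (∫ x, f x ∂(ν : Measure ℝ))) := by
      intro f hf
      induction hf using Submodule.span_induction with
      | mem f hf =>
        rcases hf with rfl | ⟨z, hz, rfl⟩
        · simp
        · rcases hz.lt_or_gt with hz' | hz'
          · have h1 : ∀ ρ : Measure ℝ, ∫ x, resolventFun z hz x ∂ρ =
                starRingEnd ℂ (∫ x : ℝ, (starRingEnd ℂ z - x)⁻¹ ∂ρ) := by
              intro ρ
              rw [← integral_conj]
              simp [resolventFun_apply]
            simp only [h1]
            exact (Complex.continuous_conj.tendsto _).comp (h _ (by simpa using hz'))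
          · exact h z hz'
      | zero => simp
      | add f g _ _ h1 h2 =>
        simp only [BoundedContinuousFunction.add_apply]
        simp only [integral_add (f.integrable _) (g.integrable _)]
        exact h1.add h2
      | smul c f _ h =>
        simp only [BoundedContinuousFunction.smul_apply, integral_smul]
        exact h.const_smul c
    intro g hg
    have hg : g ∈ closure (Submodule.span ℂ resolventFuns : Set (ℝ →ᵇ ℂ)) := hg
    -- the integrals against a probability measure are 1-Lipschitz in the uniform norm
    have hb : ∀ (ρ : Measure ℝ) [IsProbabilityMeasure ρ] (f : ℝ →ᵇ ℂ),
        dist (∫ x, g x ∂ρ) (∫ x, f x ∂ρ) ≤ dist g f := by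
      intro ρ _ f
      rw [dist_eq_norm, dist_eq_norm, ← integral_sub (g.integrable _) (f.integrable _)]
      refine (norm_integral_le_of_norm_le_const (C := ‖g - f‖)
        (.of_forall fun x => (g - f).norm_coe_le_norm x)).trans ?_
      simp
    rw [Metric.tendsto_nhds]
    intro ε hε
    obtain ⟨f, hf, hgf⟩ := Metric.mem_closure_iff.1 hg (ε / 3) (by positivity)
    filter_upwards [Metric.tendsto_nhds.1 (hspan f hf) (ε / 3) (by positivity)] with n hn
    have h1 := hb (μ n) f
    have h2 := hb ν f
    have h3 := dist_triangle4 (∫ x, g x ∂(μ n : Measure ℝ)) (∫ x, f x ∂(μ n : Measure ℝ))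
      (∫ x, f x ∂(ν : Measure ℝ)) (∫ x, g x ∂(ν : Measure ℝ))
    rw [dist_comm (∫ x, f x ∂(ν : Measure ℝ))] at h3
    linarith

/-- Measures on `ℝ` with second moment one form a tight set. -/
theorem isTightMeasureSet_of_integral_sq_eq_one {S : Set (Measure ℝ)}
    (h : ∀ μ ∈ S, ∫ x, x ^ 2 ∂μ = 1) : IsTightMeasureSet S := by
  refine isTightMeasureSet_of_tendsto_measure_norm_gt ?_
  have hlim : Tendsto (fun r : ℝ => ENNReal.ofReal ((r ^ 2)⁻¹)) atTop (𝓝 0) := by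
    rw [← ENNReal.ofReal_zero]
    exact ENNReal.tendsto_ofReal ((tendsto_pow_atTop two_ne_zero).inv_tendsto_atTop)
  refine tendsto_of_tendsto_of_tendsto_of_le_of_le' tendsto_const_nhds hlim
    (.of_forall fun _ => zero_le) ?_
  filter_upwards [eventually_gt_atTop 0] with r hr
  refine iSup₂_le fun μ hμ => ?_
  have hμ1 := h μ hμ
  have hint : Integrable (fun x : ℝ => x ^ 2) μ := by
    by_contra hn
    rw [integral_undef hn] at hμ1
    exact zero_ne_one hμ1
  have h1 : ∫⁻ x : ℝ, ENNReal.ofReal (x ^ 2) ∂μ = 1 := by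
    rw [← ofReal_integral_eq_lintegral_ofReal hint (.of_forall fun x => sq_nonneg x), hμ1,
      ENNReal.ofReal_one]
  have h2 := meas_ge_le_lintegral_div (μ := μ) (f := fun x : ℝ => ENNReal.ofReal (x ^ 2))
    (by fun_prop) (ε := ENNReal.ofReal (r ^ 2)) (by simpa using hr.ne') ENNReal.ofReal_ne_top
  rw [h1, one_div, ← ENNReal.ofReal_inv_of_pos (by positivity)] at h2
  refine (measure_mono fun x hx => ?_).trans h2
  have hx : r < ‖x‖ := hx
  refine ENNReal.ofReal_le_ofReal ?_
  rw [← sq_abs x, ← Real.norm_eq_abs]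
  gcongr

end WeakConvergence

/-! ### The limit law -/

section LimitLaw

theorem limitDensity_nonneg (l x : ℝ) : 0 ≤ limitDensity l x := by
  refine Set.indicator_nonneg (fun x hx => ?_) x
  refine div_nonneg (Real.sqrt_nonneg _) (mul_nonneg Real.pi_pos.le ?_)
  have : (x - l) ^ 2 ≤ (√2) ^ 2 := sq_le_sq' (by linarith [hx.1]) (by linarith [hx.2])
  rw [Real.sq_sqrt (by norm_num)] at this
  nlinarith [sq_nonneg l]

variable {l : ℝ}

theorem continuousOn_limitDensity (hl : 0 < l) :
    ContinuousOn (fun x => √(2 - (x - l) ^ 2) / (Real.pi * (l ^ 2 + 2 - (x - l) ^ 2)))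
      (Set.Icc (l - √2) (l + √2)) := by
  refine ContinuousOn.div (by fun_prop) (by fun_prop) fun x hx => ?_
  have : (x - l) ^ 2 ≤ (√2) ^ 2 := sq_le_sq' (by linarith [hx.1]) (by linarith [hx.2])
  rw [Real.sq_sqrt (by norm_num)] at this
  have := sq_pos_of_pos hl
  exact mul_ne_zero Real.pi_ne_zero (by linarith)

theorem integrable_limitDensity (hl : 0 < l) : Integrable (limitDensity l) := by
  refine IntegrableOn.integrable_indicator ?_ measurableSet_Ioo
  exact ((continuousOn_limitDensity hl).integrableOn_compact isCompact_Icc).mono_set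
    Set.Ioo_subset_Icc_self

/-- Integration against the limit density in the angular variable, `x = l + √2 cos θ`. -/
theorem integral_withDensity_limitDensity (hl : 0 < l) {g : ℝ → ℂ} (hg : Continuous g) :
    ∫ x, g x ∂(volume.withDensity fun x => ENNReal.ofReal (limitDensity l x)) =
      ∫ θ in (0 : ℝ)..Real.pi, ((2 * Real.sin θ ^ 2 /
        (Real.pi * (l ^ 2 + 2 - (√2 * Real.cos θ) ^ 2)) : ℝ) : ℂ) * g (l + √2 * Real.cos θ) := by
  have h2 : 0 < √2 := by positivity
  rw [integral_withDensity_eq_integral_toReal_smul₀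
    (integrable_limitDensity hl).aestronglyMeasurable.aemeasurable.ennreal_ofReal
    (.of_forall fun x => ENNReal.ofReal_lt_top)]
  simp only [ENNReal.toReal_ofReal (limitDensity_nonneg l _)]
  set p : ℝ → ℝ := fun x => √(2 - (x - l) ^ 2) / (Real.pi * (l ^ 2 + 2 - (x - l) ^ 2)) with hp
  have hind : (fun x => limitDensity l x • g x) =
      (Set.Ioo (l - √2) (l + √2)).indicator fun x => p x • g x := by
    funext x
    exact (Set.indicator_smul_apply_left _ p g x).symm
  rw [hind, integral_indicator measurableSet_Ioo, ← integral_Ioc_eq_integral_Ioo,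
    ← intervalIntegral.integral_of_le (by linarith)]
  have hsub := intervalIntegral.integral_deriv_smul_comp'' (a := Real.pi) (b := 0)
    (f := fun θ => l + √2 * Real.cos θ) (f' := fun θ => -(√2 * Real.sin θ))
    (g := fun x => p x • g x) (by fun_prop)
    (fun θ _ => by
      have := (((Real.hasDerivAt_cos θ).const_mul √2).const_add l).hasDerivWithinAt (s := Set.Ioi θ)
      rwa [mul_neg] at this) (by fun_prop)
    (by
      refine ((continuousOn_limitDensity hl).smul hg.continuousOn).mono ?_
      rintro _ ⟨θ, -, rfl⟩
      have h3 := Real.neg_one_le_cos θ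
      have h4 := Real.cos_le_one θ
      constructor <;> simp only <;> nlinarith)
  simp only [Real.cos_pi, Real.cos_zero, mul_neg, mul_one, ← sub_eq_add_neg] at hsub
  rw [← hsub, intervalIntegral.integral_symm, ← intervalIntegral.integral_neg]
  refine intervalIntegral.integral_congr fun θ hθ => ?_
  rw [Set.uIcc_of_le Real.pi_pos.le] at hθ
  have hs : 0 ≤ Real.sin θ := Real.sin_nonneg_of_mem_Icc hθ
  have hsq : (√2) ^ 2 = 2 := Real.sq_sqrt (by norm_num)
  have h5 : √(2 - (√2 * Real.cos θ) ^ 2) = √2 * Real.sin θ := by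
    rw [show 2 - (√2 * Real.cos θ) ^ 2 = (√2 * Real.sin θ) ^ 2 by
      rw [mul_pow, mul_pow, hsq, Real.sin_sq]; ring, Real.sqrt_sq (by positivity)]
  simp only [Function.comp, hp, add_sub_cancel_left, h5, neg_smul, neg_neg, Complex.real_smul]
  rw [← mul_assoc, ← Complex.ofReal_mul, ← mul_div_assoc,
    show √2 * Real.sin θ * (√2 * Real.sin θ) = √2 ^ 2 * Real.sin θ ^ 2 by ring, hsq]

/-- The integrals of `2 sin² θ / (±c - √2 cos θ)` for `c = √(l² + 2)`, where `√(c² - 2) = l`. -/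
theorem integral_sin_sq_div_sqrt_sub_cos (hl : 0 < l) {c : ℝ} (hc : 0 < c)
    (hc2 : c ^ 2 = l ^ 2 + 2) :
    Continuous (fun θ : ℝ =>
      ((2 * Real.sin θ ^ 2 : ℝ) : ℂ) * ((c : ℂ) - ((√2 * Real.cos θ : ℝ) : ℂ))⁻¹) ∧
    Continuous (fun θ : ℝ =>
      ((2 * Real.sin θ ^ 2 : ℝ) : ℂ) * (-(c : ℂ) - ((√2 * Real.cos θ : ℝ) : ℂ))⁻¹) ∧
    (∫ θ in (0 : ℝ)..Real.pi,
      ((2 * Real.sin θ ^ 2 : ℝ) : ℂ) * ((c : ℂ) - ((√2 * Real.cos θ : ℝ) : ℂ))⁻¹ =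
        Real.pi * (c - l)) ∧
    (∫ θ in (0 : ℝ)..Real.pi,
      ((2 * Real.sin θ ^ 2 : ℝ) : ℂ) * (-(c : ℂ) - ((√2 * Real.cos θ : ℝ) : ℂ))⁻¹ =
        Real.pi * (l - c)) := by
  have h1 : (l : ℂ) ^ 2 = (c : ℂ) ^ 2 - 2 := by
    rw [← Complex.ofReal_pow, ← Complex.ofReal_pow, hc2]
    push_cast
    ring
  have h1' : (-l : ℂ) ^ 2 = (-c : ℂ) ^ 2 - 2 := by rw [neg_sq, neg_sq, h1]
  have h2 : 0 < ((c : ℂ) * starRingEnd ℂ l).re := by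
    simpa using mul_pos hc hl
  have h2' : 0 < ((-c : ℂ) * starRingEnd ℂ (-l)).re := by
    simpa using mul_pos hc hl
  refine ⟨continuous_sin_sq_div_sub_cos h1 h2, continuous_sin_sq_div_sub_cos h1' h2',
    integral_sin_sq_div_sub_cos h1 h2, ?_⟩
  rw [integral_sin_sq_div_sub_cos h1' h2']
  ring

theorem sq_sub_sq_sqrt_two_mul_cos_pos (hl : 0 < l) (θ : ℝ) :
    0 < l ^ 2 + 2 - (√2 * Real.cos θ) ^ 2 := by
  have h : (√2) ^ 2 = 2 := Real.sq_sqrt (by norm_num)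
  rw [mul_pow, h, Real.cos_sq']
  nlinarith [sq_nonneg (Real.sin θ), sq_pos_of_pos hl]

theorem isProbabilityMeasure_limitLaw (hl : 0 < l) : IsProbabilityMeasure (limitLaw l) := by
  obtain ⟨c, hcd⟩ : ∃ c : ℝ, c = √(l ^ 2 + 2) := ⟨_, rfl⟩
  have hc : 0 < c := hcd ▸ by positivity
  have hc2 : c ^ 2 = l ^ 2 + 2 := hcd ▸ Real.sq_sqrt (by positivity)
  have hcC : (c : ℂ) ≠ 0 := by exact_mod_cast hc.ne'
  have hpi : (Real.pi : ℂ) ≠ 0 := by exact_mod_cast Real.pi_ne_zero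
  obtain ⟨hk1, hk2, hi1, hi2⟩ := integral_sin_sq_div_sqrt_sub_cos hl hc hc2
  have hfin : IsFiniteMeasure (volume.withDensity fun x => ENNReal.ofReal (limitDensity l x)) :=
    isFiniteMeasure_withDensity_ofReal (integrable_limitDensity hl).2
  have hmass := integral_withDensity_limitDensity hl (g := fun _ => 1) continuous_const
  have hterm : ∀ θ : ℝ, ((2 * Real.sin θ ^ 2 /
        (Real.pi * (l ^ 2 + 2 - (√2 * Real.cos θ) ^ 2)) : ℝ) : ℂ) * 1 =
      (2 * Real.pi * c : ℂ)⁻¹ * (((2 * Real.sin θ ^ 2 : ℝ) : ℂ) *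
        ((c : ℂ) - ((√2 * Real.cos θ : ℝ) : ℂ))⁻¹ - ((2 * Real.sin θ ^ 2 : ℝ) : ℂ) *
        (-(c : ℂ) - ((√2 * Real.cos θ : ℝ) : ℂ))⁻¹) := by
    intro θ
    have h := sq_sub_sq_sqrt_two_mul_cos_pos hl θ
    rw [← hc2] at h ⊢
    generalize √2 * Real.cos θ = X at h ⊢
    have h1 : (c : ℂ) - X ≠ 0 := by
      intro h0
      have : c - X = 0 := by exact_mod_cast h0
      nlinarith
    have h2 : -(c : ℂ) - X ≠ 0 := by
      intro h0
      have : -c - X = 0 := by exact_mod_cast h0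
      nlinarith
    have h3 : (c : ℂ) ^ 2 - X ^ 2 = -(c - X) * (-c - X) := by ring
    push_cast
    rw [h3]
    field_simp
    ring
  simp only [hterm] at hmass
  rw [intervalIntegral.integral_const_mul, intervalIntegral.integral_sub
    (hk1.intervalIntegrable _ _) (hk2.intervalIntegrable _ _), hi1, hi2, integral_const] at hmass
  have hreal : (volume.withDensity fun x => ENNReal.ofReal (limitDensity l x)).real Set.univ =
      1 - l / c := by
    have : ((volume.withDensity fun x => ENNReal.ofReal (limitDensity l x)).real Set.univ : ℂ) =
        ((1 - l / c : ℝ) : ℂ) := by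
      rw [Complex.real_smul, mul_one] at hmass
      rw [hmass]
      push_cast
      field_simp
      ring
    exact_mod_cast this
  have hlc : l / c ≤ 1 := by
    rw [div_le_one hc]
    nlinarith
  constructor
  rw [limitLaw, Measure.add_apply, Measure.smul_apply, measure_univ, smul_eq_mul, mul_one,
    ← ofReal_measureReal, hreal, ← hcd, ← ENNReal.ofReal_add (by positivity) (by linarith)]
  simp

/-- The Cauchy transform of the limit law at `z` is `1 / (l + √((z - l)² - 2))`. -/
theorem integral_inv_sub_limitLaw (hl : 0 < l) {z v : ℂ} (hz : 0 < z.im) (hv : 0 < v.im)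
    (hv2 : v ^ 2 = (z - l) ^ 2 - 2) :
    ∫ x : ℝ, (z - x)⁻¹ ∂(limitLaw l) = (l + v)⁻¹ := by
  have hprob := isProbabilityMeasure_limitLaw hl
  obtain ⟨c, hcd⟩ : ∃ c : ℝ, c = √(l ^ 2 + 2) := ⟨_, rfl⟩
  have hc : 0 < c := hcd ▸ by positivity
  have hc2 : c ^ 2 = l ^ 2 + 2 := hcd ▸ Real.sq_sqrt (by positivity)
  have hcC : (c : ℂ) ≠ 0 := by exact_mod_cast hc.ne'
  have hpi : (Real.pi : ℂ) ≠ 0 := by exact_mod_cast Real.pi_ne_zero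
  obtain ⟨hk1, hk2, hi1, hi2⟩ := integral_sin_sq_div_sqrt_sub_cos hl hc hc2
  obtain ⟨ζ, hζd⟩ : ∃ ζ : ℂ, ζ = z - l := ⟨_, rfl⟩
  have hζ : 0 < ζ.im := by simpa [hζd] using hz
  rw [← hζd] at hv2
  -- the real parts of `ζ` and `v` have the same sign since `Re v Im v = Re ζ Im ζ`
  have hpos : 0 < (ζ * starRingEnd ℂ v).re := by
    have him := congr_arg Complex.im hv2
    simp only [pow_two, Complex.mul_im, Complex.sub_im, Complex.im_ofNat, sub_zero] at him
    have hre : 0 ≤ ζ.re * v.re := by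
      have h1 : ζ.re * v.re * v.im = ζ.re ^ 2 * ζ.im := by linear_combination ζ.re * him / 2
      exact nonneg_of_mul_nonneg_left (h1 ▸ by positivity) hv
    simp only [Complex.mul_re, Complex.conj_re, Complex.conj_im]
    nlinarith [mul_pos hζ hv]
  have hk3 := continuous_sin_sq_div_sub_cos hv2 hpos
  have hi3 := integral_sin_sq_div_sub_cos hv2 hpos
  have hreal : ∀ a : ℝ, ζ - a ≠ 0 := fun a h => hζ.ne' (by simpa using congr_arg Complex.im h)
  have hζc : ζ - c ≠ 0 := hreal c
  have hζc' : ζ + c ≠ 0 := by simpa using hreal (-c)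
  have hres : Continuous fun x : ℝ => (z - x)⁻¹ := (resolventFun z hz.ne').continuous
  have hdens := integral_withDensity_limitDensity hl hres
  -- partial fractions in `√2 cos θ`
  have hterm : ∀ θ : ℝ, ((2 * Real.sin θ ^ 2 /
        (Real.pi * (l ^ 2 + 2 - (√2 * Real.cos θ) ^ 2)) : ℝ) : ℂ) *
          (z - ((l + √2 * Real.cos θ : ℝ) : ℂ))⁻¹ =
      (2 * Real.pi * c * (ζ - c) : ℂ)⁻¹ * (((2 * Real.sin θ ^ 2 : ℝ) : ℂ) *
        ((c : ℂ) - ((√2 * Real.cos θ : ℝ) : ℂ))⁻¹) -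
      (2 * Real.pi * c * (ζ + c) : ℂ)⁻¹ * (((2 * Real.sin θ ^ 2 : ℝ) : ℂ) *
        (-(c : ℂ) - ((√2 * Real.cos θ : ℝ) : ℂ))⁻¹) -
      (Real.pi * ((ζ - c) * (ζ + c)) : ℂ)⁻¹ * (((2 * Real.sin θ ^ 2 : ℝ) : ℂ) *
        (ζ - ((√2 * Real.cos θ : ℝ) : ℂ))⁻¹) := by
    intro θ
    have h := sq_sub_sq_sqrt_two_mul_cos_pos hl θ
    rw [← hc2] at h ⊢
    generalize √2 * Real.cos θ = X at h ⊢
    have h1 : (c : ℂ) - X ≠ 0 := by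
      intro h0
      have : c - X = 0 := by exact_mod_cast h0
      nlinarith
    have h2 : -(c : ℂ) - X ≠ 0 := by
      intro h0
      have : -c - X = 0 := by exact_mod_cast h0
      nlinarith
    have h3 : (c : ℂ) ^ 2 - X ^ 2 = -(c - X) * (-c - X) := by ring
    have h4 := hreal X
    have h5 : z - ((l + X : ℝ) : ℂ) = ζ - X := by
      rw [hζd]
      push_cast
      ring
    rw [h5]
    push_cast
    rw [h3]
    field_simp
    ring
  simp only [hterm] at hdens
  have hj1 := fun a : ℂ => (hk1.const_mul a).intervalIntegrable (μ := volume) 0 Real.pi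
  have hj2 := fun a : ℂ => (hk2.const_mul a).intervalIntegrable (μ := volume) 0 Real.pi
  have hj3 := fun a : ℂ => (hk3.const_mul a).intervalIntegrable (μ := volume) 0 Real.pi
  rw [intervalIntegral.integral_sub ((hj1 _).sub (hj2 _)) (hj3 _),
    intervalIntegral.integral_sub (hj1 _) (hj2 _),
    intervalIntegral.integral_const_mul, intervalIntegral.integral_const_mul,
    intervalIntegral.integral_const_mul, hi1, hi2, hi3] at hdens
  have hint : Integrable (fun x : ℝ => (z - x)⁻¹) (limitLaw l) :=
    (resolventFun z hz.ne').integrable _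
  rw [limitLaw] at hint ⊢
  rw [integral_add_measure (hint.mono_measure (Measure.le_add_right le_rfl))
    (hint.mono_measure (Measure.le_add_left le_rfl)), hdens, integral_smul_measure,
    integral_dirac, ENNReal.toReal_ofReal (by positivity), ← hcd, Complex.real_smul,
    show z - ((l - c : ℝ) : ℂ) = ζ + c by rw [hζd]; push_cast; ring]
  have hlv : (l : ℂ) + v ≠ 0 := fun h => hv.ne' (by simpa using congr_arg Complex.im h)
  have hkey : (ζ - c) * (ζ + c) = (v - l) * (l + v) := by
    have : (c : ℂ) ^ 2 = (l : ℂ) ^ 2 + 2 := by exact_mod_cast hc2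
    linear_combination -hv2 - this
  have hvl : v - l ≠ 0 := left_ne_zero_of_mul (hkey ▸ mul_ne_zero hζc hζc')
  trans (v - l) / ((ζ - c) * (ζ + c))
  · push_cast
    field_simp
    ring
  · rw [hkey]
    field_simp

end LimitLaw

/-! ### The vacuum laws -/

section Limit

variable {H : Type u} [NormedAddCommGroup H] [InnerProductSpace ℂ H]
  (e : HilbertBasis ℕ ℂ H)

/-- The Cauchy transform of the vacuum law is an iterate of the Euler scheme. -/
theorem integral_inv_sub_vacuumLaw (l : ℝ) {m : ℕ} (hm : 0 < m) {z : ℂ} (hz : 0 < z.im) :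
    ∫ x : ℝ, (z - x)⁻¹ ∂(vacuumLaw e l m : Measure ℝ) =
      (l + eulerIter (m : ℝ)⁻¹ (z - l) m)⁻¹ := by
  have him : ∀ k, 0 < (eulerIter (m : ℝ)⁻¹ (z - l) k).im := fun k =>
    lt_of_lt_of_le (by simpa using hz)
      (im_le_im_eulerIter (inv_nonneg.2 (Nat.cast_nonneg m)) (by simpa using hz) k)
  have hne : ∀ k, eulerIter (m : ℝ)⁻¹ (z - l) k ≠ 0 := fun k h => by
    have := him k
    simp [h] at this
  have hlne : (l : ℂ) + eulerIter (m : ℝ)⁻¹ (z - l) m ≠ 0 := fun h => by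
    have := congr_arg Complex.im h
    simp only [Complex.add_im, Complex.ofReal_im, zero_add, Complex.zero_im] at this
    exact (him m).ne' this
  -- the recursion for the coefficients starts at the largest index
  have hsol := rescaledSum_productVec e l hm (fun j => eulerIter (m : ℝ)⁻¹ (z - l) (m - j))
    (fun j _ => hne _) (fun j hj => by
      rw [show m - j = (m - (j + 1)) + 1 by omega, eulerIter_succ]
      push_cast
      rfl)
  simp only [Nat.sub_self, Nat.sub_zero] at hsol
  have h0 : eulerIter (m : ℝ)⁻¹ (z - l) 0 = z - l := rfl
  rw [h0, add_sub_cancel] at hsol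
  set b : ℕ → ℂ := fun j =>
    ((√(m : ℝ) : ℝ) : ℂ)⁻¹ / eulerIter (m : ℝ)⁻¹ (z - l) (m - (j + 1)) with hb
  set d : ℂ := l + eulerIter (m : ℝ)⁻¹ (z - l) m with hd
  refine (integral_inv_sub_vectorLaw (rescaledSum e l m) (isSelfAdjoint_rescaledSum e l m)
    (vacuum e) (norm_vacuum e) hz.ne' (d⁻¹ • productVec e b m) ?_).trans ?_
  · rw [map_smul, hsol, smul_sub, smul_smul, smul_smul, smul_smul, inv_mul_cancel₀ hlne, one_smul,
      mul_comm z]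
    abel
  · rw [inner_smul_right, inner_vacuum_productVec, mul_one]

theorem integral_sq_vacuumLaw (l : ℝ) {m : ℕ} (hm : 0 < m) :
    ∫ x : ℝ, x ^ 2 ∂(vacuumLaw e l m : Measure ℝ) = 1 := by
  refine (integral_pow_vectorLaw (rescaledSum e l m) (isSelfAdjoint_rescaledSum e l m)
    (vacuum e) 2).trans ?_
  rw [inner_vacuum_rescaledSum_sq e l hm, Complex.one_re]

end Limit

end MonotoneFock

theorem theorem5p3 {H : Type*} [NormedAddCommGroup H] [InnerProductSpace ℂ H] [CompleteSpace H]
    (e : HilbertBasis ℕ ℂ H) (l : ℝ) (hl : 0 < l) :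
    ∃ hν : IsProbabilityMeasure (MonotoneFock.limitLaw l),
      Tendsto (fun m : ℕ => MonotoneFock.vacuumLaw e l m) atTop
        (𝓝 (⟨MonotoneFock.limitLaw l, hν⟩ : ProbabilityMeasure ℝ)) := by
  refine ⟨MonotoneFock.isProbabilityMeasure_limitLaw hl, ?_⟩
  -- for `m = 0` the operator vanishes, and the second moment is not one
  rw [← tendsto_add_atTop_iff_nat 1]
  refine MonotoneFock.tendsto_of_tendsto_integral_inv_sub ?_ fun z hz => ?_
  · refine MonotoneFock.isTightMeasureSet_of_integral_sq_eq_one ?_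
    rintro _ ⟨m, rfl⟩
    exact MonotoneFock.integral_sq_vacuumLaw e l m.succ_pos
  · have hζ : 0 < (z - l).im := by simpa using hz
    obtain ⟨v, hv2, hv⟩ := MonotoneFock.exists_sq_eq_sub_two hζ
    have hlv : (l : ℂ) + v ≠ 0 := fun h => hv.ne' (by simpa using congr_arg Complex.im h)
    have hlim := ((MonotoneFock.tendsto_eulerIter hζ hv hv2).const_add (l : ℂ)).inv₀ hlv
    rw [← tendsto_add_atTop_iff_nat 1] at hlim
    refine Tendsto.congr (fun m => ?_) (hlim.trans_eq ?_)
    · exact (MonotoneFock.integral_inv_sub_vacuumLaw e l m.succ_pos hz).symm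
    · exact congr_arg 𝓝 (MonotoneFock.integral_inv_sub_limitLaw hl hz hv hv2).symm
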